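/- Let $p\ge 2$, $s \ge 1$, let $\Theta\subseteq\mathbb R^p$ be open, and let $\mathcal P=(\mathbb P_\theta)_{\theta\in\Theta}$ be a family of probability measures on a measurable space $\mathcal X$, dominated by a $\sigma$-finite measure $\mu$, with densities $f_\theta=d\mathbb P_\theta/d\mu\ge 0$ such that $(\theta,x)\mapsto f_\theta(x)$ is measurable; put $\xi_\theta=\sqrt{f_\theta}$. For $u\in\mathbb R^p$ write $u=(u_i,u_{-i})$, where $u_{-i}\in\mathbb R^{p-1}$ collects the coordinates other than the $i$-th one. A function $\varphi:\Theta\to\mathbb R$ is called nice if, for every $i\in\{1,\dots,p\}$ and Lebesgue-almost every $u_{-i}$, the function $u_i\mapsto\varphi(u_i,u_{-i})$ is absolutely continuous on every compact interval contained in the open set $\{u_i\in\mathbb R:(u_i,u_{-i})\in\Theta\}$; its partial derivatives $\partial_i\varphi$ then exist almost everywhere on $\Theta$, and $\nabla\varphi$ denotes their vector. Prior. Let $\mathbb Q$ be a probability measure on $\Theta$ with a density $q\ge 0$ with respect to Lebesgue measure on $\Theta$ that is continuous and nice, with $\int_\Theta \|\nabla q\|^2\,\frac{\mathbf 1_{\{q>0\}}}{q}\,d\theta<\infty$,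 and put $$\mathcal I_{\mathbb Q}=\int_\Theta \nabla q(\theta)\,\nabla q(\theta)^{\mathsf T}\,\frac{\mathbf 1_{\{q(\theta)>0\}}}{q(\theta)}\,d\theta .$$ Assume that $q(\theta)\to0$ as $\theta\in\Theta$ approaches any (finite) boundary point of $\Theta$ along any canonical (coordinate) direction. Model. Assume that at every $\theta\in\Theta$ with $q(\theta)>0$ the model is differentiable in $L^2(\mu)$ along canonical directions: there are $\dot\xi_{\theta,1},\dots,\dot\xi_{\theta,p}\in L^2(\mu)$ such that for every $i$ $$\bigl\|\xi_{(t,\theta_{-i})}-\xi_\theta-(t-\theta_i)\dot\xi_{\theta,i}\bigr\|_{L^2(\mu)}=o(|t-\theta_i|)\quad\text{as } t\to\theta_i .$$ With $\dot\xi_\theta=(\dot\xi_{\theta,1},\dots,\dot\xi_{\theta,p})$, put $\mathcal I_{\mathcal P}(\theta)=4\int_{\mathcal X}\dot\xi_\theta\,\dot\xi_\theta^{\mathsf T}\,d\mu$ and assume $\int_\Theta\operatorname{Tr}(\mathcal I_{\mathcal P}(\theta))\,d\mathbb Q(\theta)<\infty$. Target and statistic. Let $\psi:\Theta\to\mathbb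 R^s$ be measurable with nice components, and let $\nabla\psi(\theta)$ be the $p\times s$ matrix with entries $\partial_i\psi_j(\theta)$; assume that $\|\psi\|^2$ and $\|\nabla\psi\|$ are $\mathbb Q$-integrable. Let $S:\mathcal X\to\mathbb R^s$ be measurable with $\int_\Theta\mathbb E_\theta[\|S\|^2]\,d\mathbb Q(\theta)<\infty$, where $\mathbb E_\theta$ is the expectation under $\mathbb P_\theta$. Then $\mathcal I_{\mathbb Q}$ is positive definite, the block matrix $$\begin{bmatrix}\displaystyle\int_\Theta\mathbb E_\theta\bigl[(S-\psi(\theta))(S-\psi(\theta))^{\mathsf T}\bigr]\,d\mathbb Q(\theta) & \displaystyle\Bigl(\int_\Theta\nabla\psi\,d\mathbb Q\Bigr)^{\mathsf T}\\[2ex] \displaystyle\int_\Theta\nabla\psi\,d\mathbb Q & \displaystyle\mathcal I_{\mathbb Q}+\int_\Theta\mathcal I_{\mathcal P}(\theta)\,d\mathbb Q(\theta)\end{bmatrix}$$ is positive semidefinite, and consequently $$\int_\Theta\mathbb E_\theta\bigl[(S-\psi(\theta))(S-\psi(\theta))^{\mathsf T}\bigr]\,d\mathbb Q(\theta)-\Bigl(\int_\Theta\nabla\psi\,d\mathbb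 Q\Bigr)^{\mathsf T}\Bigl(\mathcal I_{\mathbb Q}+\int_\Theta\mathcal I_{\mathcal P}\,d\mathbb Q\Bigr)^{-1}\Bigl(\int_\Theta\nabla\psi\,d\mathbb Q\Bigr)$$ is positive semidefinite. -/

import Mathlib

open MeasureTheory Filter Topology Asymptotics
open scoped ENNReal

namespace VanTrees

noncomputable section

/-- The point `(t, v)` of `ℝ^p` whose `i`-th coordinate is `t` and whose vector of other
coordinates is `v`. -/
def insertCoord {p : ℕ} (i : Fin p) (t : ℝ) (v : {j : Fin p // j ≠ i} → ℝ) : Fin p → ℝ :=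
  fun j => if h : j = i then t else v ⟨j, h⟩

/-- Classical absolute continuity on an open subset `U` of `ℝ`: the usual `ε`-`δ` absolute
continuity on every compact interval contained in `U`. -/
def AbsContOn (U : Set ℝ) (h : ℝ → ℝ) : Prop :=
  ∀ a b : ℝ, a ≤ b → Set.Icc a b ⊆ U → AbsolutelyContinuousOnInterval h a b

/-- Nice functions on a subset `D` of `ℝ^p`: for every coordinate `i` and almost every `v` in
`ℝ^(p-1)`, the function `t ↦ φ (t, v)` is absolutely continuous on the section
`{t | (t, v) ∈ D}`. (For `v` outside the projection of `D` the section is empty.) -/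
def NiceOn {p : ℕ} (D : Set (Fin p → ℝ)) (φ : (Fin p → ℝ) → ℝ) : Prop :=
  ∀ i : Fin p, ∀ᵐ v : {j : Fin p // j ≠ i} → ℝ,
    AbsContOn {t : ℝ | insertCoord i t v ∈ D} (fun t => φ (insertCoord i t v))

/-- The partial derivative `∂ᵢ φ`. -/
def pderiv {p : ℕ} (i : Fin p) (φ : (Fin p → ℝ) → ℝ) (u : Fin p → ℝ) : ℝ :=
  deriv (fun t : ℝ => φ (Function.update u i t)) (u i)

/-- The norm of `L²(μ)`. -/
def l2norm {X : Type*} [MeasurableSpace X] (μ : Measure X) (g : X → ℝ) : ℝ :=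
  Real.sqrt (∫ x, g x ^ 2 ∂μ)

/-- `g` is an `L²(μ)`-partial derivative at `θ₀`, along the `i`-th canonical direction, of the
model with densities `f θ`, whose square roots are the functions `ξ_θ = √(f θ)`. -/
def IsL2PartialDeriv {p : ℕ} {X : Type*} [MeasurableSpace X] (μ : Measure X)
    (f : (Fin p → ℝ) → X → ℝ) (θ₀ : Fin p → ℝ) (i : Fin p) (g : X → ℝ) : Prop :=
  MemLp g 2 μ ∧
    (fun t : ℝ => l2norm μ (fun x =>
      Real.sqrt (f (Function.update θ₀ i t) x) - Real.sqrt (f θ₀ x) - (t - θ₀ i) * g x))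
      =o[𝓝 (θ₀ i)] (fun t : ℝ => t - θ₀ i)

/-- The Fisher information matrix of the model at a point at which `ξ'` is the vector of
`L²(μ)`-partial derivatives. -/
def fisherModel {p : ℕ} {X : Type*} [MeasurableSpace X] (μ : Measure X)
    (ξ' : Fin p → X → ℝ) : Matrix (Fin p) (Fin p) ℝ :=
  Matrix.of fun i k => 4 * ∫ x, ξ' i x * ξ' k x ∂μ

/-- `Q` is a well-behaved prior on `Θ`, with density `q`. -/
structure IsWellBehavedPrior {p : ℕ} (Θ : Set (Fin p → ℝ)) (Q : Measure (Fin p → ℝ))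
    (q : (Fin p → ℝ) → ℝ) : Prop where
  prob : IsProbabilityMeasure Q
  nonneg : ∀ θ ∈ Θ, 0 ≤ q θ
  density : Q = (volume.restrict Θ).withDensity (fun θ => ENNReal.ofReal (q θ))
  nice : NiceOn Θ q
  integrable : IntegrableOn
    (fun θ => (∑ i, pderiv i q θ ^ 2) * ({η | 0 < q η}.indicator 1 θ / q θ)) Θ volume

/-- The Fisher information matrix of a prior on `Θ` with density `q`. -/
def fisherPrior {p : ℕ} (Θ : Set (Fin p → ℝ)) (q : (Fin p → ℝ) → ℝ) :
    Matrix (Fin p) (Fin p) ℝ :=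
  Matrix.of fun i k =>
    ∫ θ in Θ, pderiv i q θ * pderiv k q θ * ({η | 0 < q η}.indicator 1 θ / q θ)

/-- The matrix `∫_Θ I_P(θ) dQ(θ)`, where `ξ' θ` is the vector of `L²(μ)`-partial derivatives of
the model at `θ`. -/
def meanFisher {p : ℕ} {X : Type*} [MeasurableSpace X] (μ : Measure X)
    (Θ : Set (Fin p → ℝ)) (Q : Measure (Fin p → ℝ)) (ξ' : (Fin p → ℝ) → Fin p → X → ℝ) :
    Matrix (Fin p) (Fin p) ℝ :=
  Matrix.of fun i k => ∫ θ in Θ, fisherModel μ (ξ' θ) i k ∂Q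

/-- The `p × s` matrix `∫_Θ ∇ψ(θ) dQ(θ)`, where `∇ψ(θ)` has the entries `∂ᵢ ψⱼ(θ)`. -/
def meanGrad {p s : ℕ} (Θ : Set (Fin p → ℝ)) (Q : Measure (Fin p → ℝ))
    (ψ : (Fin p → ℝ) → Fin s → ℝ) : Matrix (Fin p) (Fin s) ℝ :=
  Matrix.of fun i j => ∫ θ in Θ, pderiv i (fun η => ψ η j) θ ∂Q

/-- The `s × s` matrix `∫_Θ E_θ[(S - ψ(θ)) ⊗ (S - ψ(θ))] dQ(θ)`. -/
def meanError {p s : ℕ} {X : Type*} [MeasurableSpace X] (P : (Fin p → ℝ) → Measure X)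
    (Θ : Set (Fin p → ℝ)) (Q : Measure (Fin p → ℝ)) (S : X → Fin s → ℝ)
    (ψ : (Fin p → ℝ) → Fin s → ℝ) : Matrix (Fin s) (Fin s) ℝ :=
  Matrix.of fun j l => ∫ θ in Θ, (∫ x, (S x j - ψ θ j) * (S x l - ψ θ l) ∂(P θ)) ∂Q

/-- `q(θ) → 0` as `θ ∈ Θ` approaches any (finite) boundary point of `Θ` along any canonical
direction. -/
def VanishesAtBoundary {p : ℕ} (Θ : Set (Fin p → ℝ)) (q : (Fin p → ℝ) → ℝ) : Prop :=
  ∀ i : Fin p, ∀ b ∈ frontier Θ,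
    Tendsto (fun t : ℝ => q (Function.update b i t))
      (𝓝[{t : ℝ | Function.update b i t ∈ Θ}] (b i)) (𝓝 0)

end

end VanTrees

namespace VanTrees

/-! The block matrix is a Gram matrix. On `posSet Θ q`, where the prior density is positive,
consider in `L²(μ)` the errors `(S_j - ψ_j(θ)) √f_θ` and the joint scores `(∂ᵢq/q)(θ) √f_θ + 2
ξ'_{θ,i}`. Their inner products, weighted by `q` and integrated in `θ`, form a positive semidefinite
matrix (`posSemidef_integral_gram`). The error block is the mean error by definition. In the score
block the mixed terms vanish because model scores are centred, so the two informations add.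

The cross block is where the work lies. Its integrand is `q · 2∫ S_j √f ξ'_i dμ + E_θ[S_j] ∂ᵢq - ψ_j
∂ᵢq`. The first two terms form the `i`-th derivative of `q E_θ[S_j]` and integrate to zero
(`setIntegral_statistic`); the last integrates to `∫ ∂ᵢψ_j dQ` by parts
(`setIntegral_pderiv_mul_add`).

Both facts come from one integration by parts for a bounded `φ` against `q` along coordinate lines.
The slices of `{q > 0}` are open and `q` tends to zero at their ends, so `g = (φ + C) q` is
nonnegative with the same property. Its extension by zero is absolutely continuous, has derivative
zero off the slice since it attains its minimum there, and tends to zero at infinity because it and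
its derivative are integrable. Hence `g'` has integral zero (`setIntegral_deriv_eq_zero_of_nonneg`).
Unbounded `ψ` and `S` are reached by truncation and dominated convergence.

If the prior information degenerated in a direction `w`, the derivative of `q` along `w` would
vanish almost everywhere; integrating by parts against `arctan (w ⬝ᵥ θ)` would then force `q` to
have mass zero. Its definiteness makes the lower right block invertible, and a Schur complement
gives the final inequality. -/

/-! ### Extension by zero on the line -/

theorem absolutelyContinuousOnInterval_of_dist_le {X Y : Type*} [PseudoMetricSpace X]
    [PseudoMetricSpace Y] {f : ℝ → X} {k : ℝ → Y} {a b C : ℝ}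
    (hk : AbsolutelyContinuousOnInterval k a b)
    (h : ∀ x ∈ Set.uIcc a b, ∀ y ∈ Set.uIcc a b, dist (f x) (f y) ≤ C * dist (k x) (k y)) :
    AbsolutelyContinuousOnInterval f a b := by
  have hC : Tendsto (fun E : ℕ × (ℕ → ℝ × ℝ) =>
      C * ∑ i ∈ Finset.range E.1, dist (k (E.2 i).1) (k (E.2 i).2))
      (AbsolutelyContinuousOnInterval.totalLengthFilter ⊓
        𝓟 (AbsolutelyContinuousOnInterval.disjWithin a b)) (𝓝 0) := by
    simpa using Tendsto.const_mul C hk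
  refine squeeze_zero' (Eventually.of_forall fun E => Finset.sum_nonneg fun i _ => dist_nonneg)
    ?_ hC
  filter_upwards [mem_inf_of_right (mem_principal_self _)] with E hE
  rw [Finset.mul_sum]
  exact Finset.sum_le_sum fun i hi => h _ (hE.1 i hi).1 _ (hE.1 i hi).2

/-- A function on an open set `U` that vanishes at the boundary of `U`, and whose increments over
the compact intervals of `U` are controlled by the integral of `k`, is controlled in the same way
on an interval that leaves `U`, up to its first exit. -/
theorem exists_abs_indicator_le_integral {U : Set ℝ} (hU : IsOpen U) {g k : ℝ → ℝ}
    (hk : Integrable k) (hk0 : 0 ≤ k)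
    (hg : ∀ a b : ℝ, a ≤ b → Set.Icc a b ⊆ U → |g b - g a| ≤ ∫ t in a..b, k t)
    (hb : ∀ b ∈ frontier U, Tendsto g (𝓝[U] b) (𝓝 0))
    {a b : ℝ} (hout : ¬ Set.Icc a b ⊆ U) :
    ∃ c ∈ Set.Icc a b, (∀ t ∈ Set.Ico a c, t ∈ U) ∧ c ∉ U ∧
      |U.indicator g a| ≤ ∫ t in a..c, k t := by
  have hK : IsCompact (Set.Icc a b \ U) := isCompact_Icc.diff hU
  have hne : (Set.Icc a b \ U).Nonempty := by
    rw [Set.not_subset] at hout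
    exact hout
  obtain ⟨c, ⟨⟨hac, hcb⟩, hcU⟩, hc⟩ := hK.exists_isLeast hne
  have hin : ∀ t ∈ Set.Ico a c, t ∈ U := by
    intro t ht
    by_contra hn
    exact absurd (hc ⟨⟨ht.1, ht.2.le.trans hcb⟩, hn⟩) (not_le.2 ht.2)
  refine ⟨c, ⟨hac, hcb⟩, hin, hcU, ?_⟩
  rcases hac.eq_or_lt with rfl | hac
  · simp [hcU]
  have haU : a ∈ U := hin a ⟨le_rfl, hac⟩
  rw [Set.indicator_of_mem haU]
  have hcl : c ∈ closure (Set.Ico a c) := by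
    rw [closure_Ico hac.ne]
    exact ⟨hac.le, le_rfl⟩
  have hcfr : c ∈ frontier U := by
    rw [frontier, hU.interior_eq]
    exact ⟨closure_mono hin hcl, hcU⟩
  -- Let `t` increase to the boundary point `c`, where `g` tends to zero, in the bound for `|g t - g
  -- a|`.
  have hbot : (𝓝[Set.Ico a c] c).NeBot := mem_closure_iff_nhdsWithin_neBot.1 hcl
  have hlim : Tendsto (fun t => |g t - g a|) (𝓝[Set.Ico a c] c) (𝓝 |0 - g a|) :=
    (((hb c hcfr).mono_left (nhdsWithin_mono _ hin)).sub tendsto_const_nhds).abs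
  rw [zero_sub, abs_neg] at hlim
  refine le_of_tendsto hlim ?_
  filter_upwards [self_mem_nhdsWithin] with t ht
  refine (hg a t ht.1 fun r hr => hin r ⟨hr.1, hr.2.trans_lt ht.2⟩).trans ?_
  exact intervalIntegral.integral_mono_interval le_rfl ht.1 ht.2.le
    (Eventually.of_forall hk0) hk.intervalIntegrable

/-- Increments of the extension by zero. -/
theorem abs_indicator_sub_le_integral {U : Set ℝ} (hU : IsOpen U) {g k : ℝ → ℝ}
    (hk : Integrable k) (hk0 : 0 ≤ k)
    (hg : ∀ a b : ℝ, a ≤ b → Set.Icc a b ⊆ U → |g b - g a| ≤ ∫ t in a..b, k t)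
    (hb : ∀ b ∈ frontier U, Tendsto g (𝓝[U] b) (𝓝 0)) {a b : ℝ} (hab : a ≤ b) :
    |U.indicator g b - U.indicator g a| ≤ ∫ t in a..b, k t := by
  by_cases hsub : Set.Icc a b ⊆ U
  · rw [Set.indicator_of_mem (hsub ⟨le_rfl, hab⟩), Set.indicator_of_mem (hsub ⟨hab, le_rfl⟩)]
    exact hg a b hab hsub
  obtain ⟨c, hc, hcin, hcU, hca⟩ := exists_abs_indicator_le_integral hU hk hk0 hg hb hsub
  -- Reflecting the line yields `-d`, the last point of `[a, b]` outside `U`. Since `c ≤ -d`, the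
  -- two bounds use integrals over non-overlapping intervals.
  have hsub' : ¬ Set.Icc (-b) (-a) ⊆ -U := by
    intro h
    refine hsub fun t ht => ?_
    have := h (show -t ∈ Set.Icc (-b) (-a) from ⟨neg_le_neg ht.2, neg_le_neg ht.1⟩)
    simpa using this
  have hfr : frontier (-U) = -frontier U := ((Homeomorph.neg ℝ).preimage_frontier U).symm
  obtain ⟨d, hd, -, hdU, hda⟩ := exists_abs_indicator_le_integral (U := -U) hU.neg
    (g := fun t => g (-t)) (k := fun t => k (-t)) hk.comp_neg (fun t => hk0 (-t))
    (fun x y hxy h => by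
      rw [intervalIntegral.integral_comp_neg, abs_sub_comm]
      refine hg _ _ (neg_le_neg hxy) fun t ht => ?_
      have := h (show -t ∈ Set.Icc x y from ⟨by linarith [ht.2], by linarith [ht.1]⟩)
      simpa using this)
    (fun x hx => by
      rw [hfr] at hx
      refine (hb _ hx).comp (tendsto_nhdsWithin_iff.2 ⟨?_, ?_⟩)
      · exact (continuous_neg.tendsto x).mono_left nhdsWithin_le_nhds
      · exact self_mem_nhdsWithin) hsub'
  rw [intervalIntegral.integral_comp_neg, neg_neg] at hda
  have hcd : c ≤ -d := by
    by_contra hlt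
    push Not at hlt
    exact hdU (by simpa using hcin (-d) ⟨by linarith [hd.2], hlt⟩)
  have hind : (-U).indicator (fun t => g (-t)) (-b) = U.indicator g b := by
    by_cases hbU : b ∈ U <;> simp [hbU]
  rw [hind] at hda
  have hi : ∀ x y, IntervalIntegrable k volume x y := fun x y => hk.intervalIntegrable
  have hmid : 0 ≤ ∫ t in c..(-d), k t :=
    intervalIntegral.integral_nonneg hcd fun t _ => hk0 t
  have h1 := intervalIntegral.integral_add_adjacent_intervals (hi a c) (hi c (-d))
  have h2 := intervalIntegral.integral_add_adjacent_intervals (hi a (-d)) (hi (-d) b)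
  calc |U.indicator g b - U.indicator g a| ≤ |U.indicator g b| + |U.indicator g a| := abs_sub _ _
    _ ≤ _ := by linarith

/-- A nonnegative integrable function on an open subset of the line that is absolutely continuous
on the compact intervals of that subset, has an integrable derivative and vanishes at the
boundary has a derivative of integral zero. -/
theorem setIntegral_deriv_eq_zero_of_nonneg {U : Set ℝ} (hU : IsOpen U) {g : ℝ → ℝ}
    (hg : AbsContOn U g) (hb : ∀ b ∈ frontier U, Tendsto g (𝓝[U] b) (𝓝 0))
    (hg0 : ∀ t ∈ U, 0 ≤ g t) (hi : IntegrableOn g U) (hd : IntegrableOn (deriv g) U) :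
    ∫ t in U, deriv g t = 0 := by
  set G := U.indicator g with hG
  set k : ℝ → ℝ := U.indicator fun t => |deriv g t| with hk
  have hkI : Integrable k := (integrable_indicator_iff hU.measurableSet).2 hd.abs
  have hk0 : 0 ≤ k := fun x => Set.indicator_nonneg (fun _ _ => abs_nonneg _) _
  have hinc : ∀ a b : ℝ, a ≤ b → Set.Icc a b ⊆ U → |g b - g a| ≤ ∫ t in a..b, k t := by
    intro a b hab hsub
    rw [← (hg a b hab hsub).integral_deriv_eq_sub]
    refine (intervalIntegral.abs_integral_le_integral_abs hab).trans_eq ?_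
    refine intervalIntegral.integral_congr fun x hx => ?_
    rw [Set.uIcc_of_le hab] at hx
    simp [hk, hsub hx]
  have hdist : ∀ x y : ℝ, dist (G x) (G y) ≤
      1 * dist (∫ t in (0 : ℝ)..x, k t) (∫ t in (0 : ℝ)..y, k t) := by
    have key : ∀ x y : ℝ, x ≤ y → dist (G x) (G y) ≤
        1 * dist (∫ t in (0 : ℝ)..x, k t) (∫ t in (0 : ℝ)..y, k t) := by
      intro x y hxy
      rw [one_mul, dist_comm, Real.dist_eq, dist_comm, Real.dist_eq,
        intervalIntegral.integral_interval_sub_left hkI.intervalIntegrable hkI.intervalIntegrable]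
      exact (abs_indicator_sub_le_integral hU hkI hk0 hinc hb hxy).trans (le_abs_self _)
    intro x y
    rcases le_total x y with h | h
    · exact key x y h
    · rw [dist_comm, dist_comm (∫ t in (0 : ℝ)..x, k t)]
      exact key y x h
  have hGac : ∀ R : ℝ, 0 ≤ R → AbsolutelyContinuousOnInterval G (-R) R := fun R hR =>
    absolutelyContinuousOnInterval_of_dist_le
      (hkI.intervalIntegrable.absolutelyContinuousOnInterval_intervalIntegral
        (by rw [Set.uIcc_of_le (by linarith)]; exact ⟨by linarith, hR⟩))
      fun x _ y _ => hdist x y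
  have hGd : deriv G = U.indicator (deriv g) := by
    funext t
    by_cases ht : t ∈ U
    · rw [Set.indicator_of_mem ht]
      refine EventuallyEq.deriv_eq ?_
      filter_upwards [hU.mem_nhds ht] with x hx
      rw [hG, Set.indicator_of_mem hx]
    · rw [Set.indicator_of_notMem ht]
      -- Nonnegativity of `g` enters here: off `U` the extension attains its minimum `0`, so no
      -- null-set argument on the boundary of `U` is needed.
      refine IsLocalMin.deriv_eq_zero (Eventually.of_forall fun x => ?_)
      rw [hG, Set.indicator_of_notMem ht]
      exact Set.indicator_nonneg hg0 x
  have hGI : Integrable G := (integrable_indicator_iff hU.measurableSet).2 hi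
  have hdI : Integrable (deriv G) := by
    rw [hGd]
    exact (integrable_indicator_iff hU.measurableSet).2 hd
  have hsub : ∀ x y : ℝ, G y - G x = ∫ t in x..y, deriv G t := by
    intro x y
    refine (AbsolutelyContinuousOnInterval.integral_deriv_eq_sub ?_).symm
    refine (hGac (max |x| |y|) (by positivity)).mono fun t ht => ?_
    rw [Set.uIcc_of_le (by linarith [show 0 ≤ max |x| |y| by positivity])]
    have h1 := le_max_left |x| |y|
    have h2 := le_max_right |x| |y|
    have h3 := neg_abs_le x
    have h4 := neg_abs_le y
    have h5 := le_abs_self x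
    have h6 := le_abs_self y
    rw [Set.mem_uIcc] at ht
    constructor <;> rcases ht with ht | ht <;> linarith [ht.1, ht.2]
  have htop : Tendsto G atTop (𝓝 0) := by
    have hlim : Tendsto G atTop (𝓝 (G 0 + ∫ t in Set.Ioi 0, deriv G t)) := by
      have := (intervalIntegral_tendsto_integral_Ioi (0 : ℝ) hdI.integrableOn
        tendsto_id).const_add (G 0)
      refine this.congr fun x => ?_
      rw [← hsub]; simp
    -- The limit exists because the derivative is integrable; it is zero because `G` is integrable
    -- and every half-line has infinite measure.
    have h0 := IntegrableAtFilter.eq_zero_of_tendsto (μ := volume)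
      ⟨Set.univ, univ_mem, hGI.integrableOn⟩ (fun s hs => by
        obtain ⟨a, ha⟩ := mem_atTop_sets.1 hs
        exact top_le_iff.1 ((Real.volume_Ici (a := a)).ge.trans (measure_mono ha))) hlim
    rwa [h0] at hlim
  have hbot : Tendsto G atBot (𝓝 0) := by
    have hlim : Tendsto G atBot (𝓝 (G 0 - ∫ t in Set.Iic 0, deriv G t)) := by
      have := (intervalIntegral_tendsto_integral_Iic (0 : ℝ) hdI.integrableOn
        tendsto_id).const_sub (G 0)
      refine this.congr fun x => ?_
      rw [← hsub]; simp
    have h0 := IntegrableAtFilter.eq_zero_of_tendsto (μ := volume)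
      ⟨Set.univ, univ_mem, hGI.integrableOn⟩ (fun s hs => by
        obtain ⟨a, ha⟩ := mem_atBot_sets.1 hs
        exact top_le_iff.1 ((Real.volume_Iic (a := a)).ge.trans (measure_mono ha))) hlim
    rwa [h0] at hlim
  have h1 := intervalIntegral_tendsto_integral hdI tendsto_neg_atTop_atBot tendsto_id
  have h2 : Tendsto (fun i : ℝ => ∫ x in -i..id i, deriv G x) atTop (𝓝 0) := by
    have := htop.sub (hbot.comp tendsto_neg_atTop_atBot)
    rw [sub_zero] at this
    refine this.congr fun x => ?_
    rw [← hsub]; simp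
  have h3 := tendsto_nhds_unique h1 h2
  rwa [hGd, integral_indicator hU.measurableSet] at h3

/-! ### Absolute continuity and integration by parts on open subsets of the line -/

theorem AbsContOn.mul {U : Set ℝ} {f g : ℝ → ℝ} (hf : AbsContOn U f) (hg : AbsContOn U g) :
    AbsContOn U fun t => f t * g t :=
  fun a b hab h => (hf a b hab h).fun_mul (hg a b hab h)

theorem AbsContOn.add {U : Set ℝ} {f g : ℝ → ℝ} (hf : AbsContOn U f) (hg : AbsContOn U g) :
    AbsContOn U fun t => f t + g t :=
  fun a b hab h => (hf a b hab h).fun_add (hg a b hab h)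

theorem absContOn_const (U : Set ℝ) (c : ℝ) : AbsContOn U fun _ => c := fun _ _ _ _ =>
  (LipschitzOnWith.of_dist_le_mul (K := 0) (by simp)).absolutelyContinuousOnInterval

theorem AbsContOn.mono {U V : Set ℝ} {f : ℝ → ℝ} (hf : AbsContOn V f) (h : U ⊆ V) :
    AbsContOn U f := fun a b hab hs => hf a b hab (hs.trans h)

theorem AbsContOn.comp_lipschitz {U : Set ℝ} {f F : ℝ → ℝ} {C : ℝ} (hf : AbsContOn U f)
    (hF : ∀ x y, |F x - F y| ≤ C * |x - y|) : AbsContOn U fun t => F (f t) := fun a b hab hs =>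
  absolutelyContinuousOnInterval_of_dist_le (hf a b hab hs) fun _ _ _ _ => hF _ _

theorem AbsContOn.continuousOn {U : Set ℝ} {f : ℝ → ℝ} (hU : IsOpen U) (hf : AbsContOn U f) :
    ContinuousOn f U := by
  intro t ht
  obtain ⟨ε, hε, hball⟩ := Metric.nhds_basis_closedBall.mem_iff.1 (hU.mem_nhds ht)
  rw [Real.closedBall_eq_Icc] at hball
  have hc := (hf (t - ε) (t + ε) (by linarith) hball).continuousOn
  rw [Set.uIcc_of_le (by linarith)] at hc
  exact (hc.continuousAt (Icc_mem_nhds (by linarith) (by linarith))).continuousWithinAt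

/-- The compact intervals with rational endpoints contained in `U` are countably many and cover `U`,
so their exceptional null sets can be united. -/
theorem AbsContOn.ae_differentiableAt {U : Set ℝ} {f : ℝ → ℝ} (hU : IsOpen U)
    (hf : AbsContOn U f) : ∀ᵐ t, t ∈ U → DifferentiableAt ℝ f t := by
  have h : ∀ r s : ℚ, ∀ᵐ t : ℝ, Set.Icc (r : ℝ) s ⊆ U → t ∈ Set.Icc (r : ℝ) s →
      DifferentiableAt ℝ f t := by
    intro r s
    by_cases hrs : (r : ℝ) ≤ s ∧ Set.Icc (r : ℝ) s ⊆ U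
    · filter_upwards [(hf r s hrs.1 hrs.2).ae_differentiableAt] with t ht _ hts
      exact ht (by rwa [Set.uIcc_of_le hrs.1])
    · refine Eventually.of_forall fun t h1 h2 => absurd ⟨h2.1.trans h2.2, h1⟩ hrs
  filter_upwards [ae_all_iff.2 fun r => ae_all_iff.2 (h r)] with t ht htU
  obtain ⟨ε, hε, hball⟩ := Metric.isOpen_iff.1 hU t htU
  obtain ⟨r, hr1, hr2⟩ := exists_rat_btwn (show t - ε < t by linarith)
  obtain ⟨s, hs1, hs2⟩ := exists_rat_btwn (show t < t + ε by linarith)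
  refine ht r s (fun x hx => hball ?_) ⟨hr2.le, hs1.le⟩
  rw [Real.ball_eq_Ioo]
  exact ⟨hr1.trans_le hx.1, hx.2.trans_lt hs2⟩

/-- Integration by parts on an open subset of the line, for a bounded function against a
nonnegative function that vanishes at the boundary. -/
theorem setIntegral_deriv_mul_add_eq_zero {U : Set ℝ} (hU : IsOpen U) {q φ φ' : ℝ → ℝ} {C : ℝ}
    (hq : AbsContOn U q) (hφ : AbsContOn U φ)
    (hb : ∀ b ∈ frontier U, Tendsto q (𝓝[U] b) (𝓝 0))
    (hq0 : ∀ t ∈ U, 0 ≤ q t) (hφC : ∀ t ∈ U, |φ t| ≤ C)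
    (hqi : IntegrableOn q U) (hqd : IntegrableOn (deriv q) U)
    (hφ' : ∀ᵐ t, t ∈ U → deriv φ t = φ' t) (hφd : IntegrableOn (fun t => φ' t * q t) U) :
    ∫ t in U, (φ' t * q t + φ t * deriv q t) = 0 := by
  have hφm : AEStronglyMeasurable φ (volume.restrict U) :=
    (hφ.continuousOn hU).aestronglyMeasurable hU.measurableSet
  have hbdd : ∀ᵐ t ∂volume.restrict U, ‖φ t‖ ≤ C :=
    (ae_restrict_iff' hU.measurableSet).2 (Eventually.of_forall hφC)
  have hφq : IntegrableOn (fun t => φ t * q t) U := hqi.bdd_mul hφm hbdd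
  have hφdq : IntegrableOn (fun t => φ t * deriv q t) U := hqd.bdd_mul hφm hbdd
  -- Adding `C` to `φ` makes the product with `q` nonnegative; the extra term `C * deriv q` has
  -- integral zero by the same lemma applied to `q`.
  have hsq := setIntegral_deriv_eq_zero_of_nonneg hU hq hb hq0 hqi hqd
  have hd : ∀ᵐ t ∂volume.restrict U, deriv (fun t => (φ t + C) * q t) t =
      φ' t * q t + φ t * deriv q t + C * deriv q t := by
    refine (ae_restrict_iff' hU.measurableSet).2 ?_
    filter_upwards [hq.ae_differentiableAt hU, hφ.ae_differentiableAt hU, hφ'] with t h1 h2 h3 ht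
    have := ((h2 ht).hasDerivAt.add_const C).mul (h1 ht).hasDerivAt
    rw [h3 ht] at this
    rw [show (fun t => (φ t + C) * q t) = (fun t => φ t + C) * q from rfl, this.deriv]
    ring
  have hlim : ∀ b ∈ frontier U, Tendsto (fun t => (φ t + C) * q t) (𝓝[U] b) (𝓝 0) := by
    intro b hbf
    have h2 : Tendsto (fun t => (2 * C) * q t) (𝓝[U] b) (𝓝 0) := by
      simpa using (hb b hbf).const_mul (2 * C)
    refine squeeze_zero_norm' ?_ h2
    filter_upwards [self_mem_nhdsWithin] with t ht
    rw [norm_mul, Real.norm_of_nonneg (hq0 t ht)]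
    refine mul_le_mul_of_nonneg_right ?_ (hq0 t ht)
    have := abs_le.1 (hφC t ht)
    rw [Real.norm_eq_abs, abs_le]
    constructor <;> linarith
  have hmain := setIntegral_deriv_eq_zero_of_nonneg hU
    (g := fun t => (φ t + C) * q t) ((hφ.add (absContOn_const U C)).mul hq) hlim
    (fun t ht => mul_nonneg (by linarith [(abs_le.1 (hφC t ht)).1]) (hq0 t ht))
    (by simp only [add_mul]; exact hφq.add (hqi.const_mul C))
    (((hφd.add hφdq).add (hqd.const_mul C)).congr (hd.mono fun t h => h.symm))
  have hsum : IntegrableOn (fun t => φ' t * q t + φ t * deriv q t) U := hφd.add hφdq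
  rw [integral_congr_ae hd, integral_add hsum (hqd.const_mul C), integral_const_mul, hsq,
    mul_zero, add_zero] at hmain
  exact hmain

/-! ### Slicing along a coordinate and integration by parts in `ℝ^p` -/

/-- The splitting of `ℝ^p` into the coordinates other than the `i`-th one and the `i`-th one. -/
noncomputable def insertCoordEquiv {p : ℕ} (i : Fin p) :
    (({j : Fin p // j ≠ i} → ℝ) × ℝ) ≃ᵐ (Fin p → ℝ) where
  toFun z := insertCoord i z.2 z.1
  invFun θ := (fun j => θ j, θ i)
  left_inv z := by
    ext j
    · simp [insertCoord, j.2]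
    · simp [insertCoord]
  right_inv θ := by
    funext j
    by_cases h : j = i
    · subst h; simp [insertCoord]
    · simp [insertCoord, h]
  measurable_toFun := by
    refine measurable_pi_lambda _ fun j => ?_
    by_cases h : j = i
    · simpa [insertCoord, h] using measurable_snd
    · simpa [insertCoord, h, Function.comp_def] using
        (measurable_pi_apply (⟨j, h⟩ : {j : Fin p // j ≠ i})).comp
        (measurable_fst (β := ℝ))
  measurable_invFun := by
    refine Measurable.prodMk (measurable_pi_lambda _ fun j => ?_) (measurable_pi_apply i)
    exact measurable_pi_apply _

theorem insertCoordEquiv_apply {p : ℕ} (i : Fin p) (z : ({j : Fin p // j ≠ i} → ℝ) × ℝ) :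
    insertCoordEquiv i z = insertCoord i z.2 z.1 := rfl

/-- The map swaps the factors, identifies `ℝ` with the functions on the one-point index type `{j //
j = i}`, and glues the two groups of coordinates; each of these preserves volume. -/
theorem measurePreserving_insertCoordEquiv {p : ℕ} (i : Fin p) :
    MeasurePreserving (insertCoordEquiv i) (volume.prod volume) volume := by
  have h1 := (volume_preserving_piEquivPiSubtypeProd (fun _ : Fin p => ℝ) (fun j => j = i)).symm
  have h2 := (volume_preserving_funUnique {j : Fin p // j = i} ℝ).symm
  have h3 := h2.prod (MeasurePreserving.id (volume : Measure ({j : Fin p // j ≠ i} → ℝ)))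
  have h4 : MeasurePreserving (Prod.swap (α := {j : Fin p // j ≠ i} → ℝ) (β := ℝ))
      (volume.prod volume) (volume.prod volume) := Measure.measurePreserving_swap
  have h1' : MeasurePreserving (MeasurableEquiv.piEquivPiSubtypeProd (fun _ : Fin p => ℝ)
      (fun j => j = i)).symm ((volume : Measure ({j : Fin p // j = i} → ℝ)).prod
        (volume : Measure ({j : Fin p // j ≠ i} → ℝ))) volume := by
    convert h1 using 1
    · rfl
    · rw [Measure.volume_eq_prod]
      congr!
  convert h1'.comp (h3.comp h4) using 1
  funext z j
  by_cases h : j = i <;>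
    simp [insertCoordEquiv_apply, insertCoord, MeasurableEquiv.piEquivPiSubtypeProd,
      Equiv.piEquivPiSubtypeProd, h, MeasurableEquiv.funUnique, MeasurableEquiv.piUnique]

theorem continuous_insertCoord {p : ℕ} (i : Fin p) (v : {j : Fin p // j ≠ i} → ℝ) :
    Continuous fun t => insertCoord i t v := by
  refine continuous_pi fun j => ?_
  by_cases h : j = i
  · simpa [insertCoord, h] using continuous_id'
  · simpa [insertCoord, h] using continuous_const

theorem update_insertCoord {p : ℕ} (i : Fin p) (s t : ℝ) (v : {j : Fin p // j ≠ i} → ℝ) :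
    Function.update (insertCoord i s v) i t = insertCoord i t v := by
  funext j
  by_cases h : j = i
  · subst h; simp [insertCoord]
  · simp [insertCoord, h]

theorem insertCoord_self {p : ℕ} (i : Fin p) (t : ℝ) (v : {j : Fin p // j ≠ i} → ℝ) :
    insertCoord i t v i = t := by simp [insertCoord]

theorem pderiv_insertCoord {p : ℕ} (i : Fin p) (φ : (Fin p → ℝ) → ℝ) (t : ℝ)
    (v : {j : Fin p // j ≠ i} → ℝ) :
    pderiv i φ (insertCoord i t v) = deriv (fun r => φ (insertCoord i r v)) t := by
  simp only [pderiv, update_insertCoord, insertCoord_self]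

theorem integrable_insertCoord {p : ℕ} (i : Fin p) {D : Set (Fin p → ℝ)} (hD : MeasurableSet D)
    {F : (Fin p → ℝ) → ℝ} (hF : IntegrableOn F D) :
    ∀ᵐ v : {j : Fin p // j ≠ i} → ℝ,
      IntegrableOn (fun t => F (insertCoord i t v)) {t | insertCoord i t v ∈ D} := by
  have h1 := (measurePreserving_insertCoordEquiv i).integrable_comp_of_integrable
    ((integrable_indicator_iff hD).2 hF)
  filter_upwards [h1.prod_right_ae] with v hv
  refine (integrable_indicator_iff
    ((continuous_insertCoord i v).measurable hD)).1 (hv.congr (Eventually.of_forall fun t => ?_))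
  simp only [Function.comp, insertCoordEquiv_apply, Set.indicator]
  rfl

theorem setIntegral_eq_integral_insertCoord {p : ℕ} (i : Fin p) {D : Set (Fin p → ℝ)}
    (hD : MeasurableSet D) {F : (Fin p → ℝ) → ℝ} (hF : IntegrableOn F D) :
    ∫ θ in D, F θ = ∫ v : {j : Fin p // j ≠ i} → ℝ, ∫ t in {t | insertCoord i t v ∈ D},
      F (insertCoord i t v) := by
  have h1 := (measurePreserving_insertCoordEquiv i).integrable_comp_of_integrable
    ((integrable_indicator_iff hD).2 hF)
  rw [← integral_indicator hD, ← (measurePreserving_insertCoordEquiv i).integral_comp',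
    integral_prod (fun z => D.indicator F (insertCoordEquiv i z)) h1]
  refine integral_congr_ae (Eventually.of_forall fun v => ?_)
  simp only
  have hm : MeasurableSet {t | insertCoord i t v ∈ D} :=
    (continuous_insertCoord i v).measurable hD
  rw [← integral_indicator hm]
  refine integral_congr_ae (Eventually.of_forall fun t => ?_)
  simp only [insertCoordEquiv_apply, Set.indicator]
  rfl

/-- Integration by parts in one coordinate, for a bounded function `φ` with partial derivative
`φ'` along almost every line, against a nonnegative function that vanishes at the boundary. -/
theorem setIntegral_mul_add_mul_pderiv_eq_zero {p : ℕ} (i : Fin p) {D : Set (Fin p → ℝ)}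
    (hD : IsOpen D) {q φ φ' : (Fin p → ℝ) → ℝ} {C : ℝ}
    (hq : ∀ᵐ v : {j : Fin p // j ≠ i} → ℝ,
      AbsContOn {t | insertCoord i t v ∈ D} fun t => q (insertCoord i t v))
    (hφ : ∀ᵐ v : {j : Fin p // j ≠ i} → ℝ,
      AbsContOn {t | insertCoord i t v ∈ D} fun t => φ (insertCoord i t v))
    (hb : ∀ v : {j : Fin p // j ≠ i} → ℝ, ∀ b ∈ frontier {t | insertCoord i t v ∈ D},
      Tendsto (fun t => q (insertCoord i t v)) (𝓝[{t | insertCoord i t v ∈ D}] b) (𝓝 0))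
    (hq0 : ∀ θ ∈ D, 0 ≤ q θ) (hφC : ∀ θ ∈ D, |φ θ| ≤ C)
    (hφm : AEStronglyMeasurable φ (volume.restrict D))
    (hqi : IntegrableOn q D) (hqd : IntegrableOn (pderiv i q) D)
    (hφ' : ∀ᵐ v : {j : Fin p // j ≠ i} → ℝ, ∀ᵐ t : ℝ, insertCoord i t v ∈ D →
      deriv (fun t => φ (insertCoord i t v)) t = φ' (insertCoord i t v))
    (hφd : IntegrableOn (fun θ => φ' θ * q θ) D) :
    ∫ θ in D, (φ' θ * q θ + φ θ * pderiv i q θ) = 0 := by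
  have hφq : IntegrableOn (fun θ => φ θ * pderiv i q θ) D := hqd.bdd_mul hφm
    ((ae_restrict_iff' hD.measurableSet).2 (Eventually.of_forall hφC))
  rw [setIntegral_eq_integral_insertCoord i hD.measurableSet
    (F := fun θ => φ' θ * q θ + φ θ * pderiv i q θ) (hφd.add hφq)]
  refine integral_eq_zero_of_ae ?_
  filter_upwards [hq, hφ, hφ', integrable_insertCoord i hD.measurableSet hqi,
    integrable_insertCoord i hD.measurableSet hqd,
    integrable_insertCoord i hD.measurableSet hφd] with v h1 h2 h3 h4 h5 h6
  simp only [pderiv_insertCoord] at h5 ⊢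
  exact setIntegral_deriv_mul_add_eq_zero (hD.preimage (continuous_insertCoord i v)) h1 h2
    (hb v) (fun t ht => hq0 _ ht) (fun t ht => hφC _ ht) h4 h5 h3 h6

/-! ### Measurability of partial derivatives -/

theorem NiceOn.mono {p : ℕ} {D Θ : Set (Fin p → ℝ)} {φ : (Fin p → ℝ) → ℝ} (h : NiceOn Θ φ)
    (hD : D ⊆ Θ) : NiceOn D φ := fun i => by
  filter_upwards [h i] with v hv
  exact hv.mono fun t ht => hD ht

theorem pderiv_eq_lineDeriv {p : ℕ} (i : Fin p) (φ : (Fin p → ℝ) → ℝ) (θ : Fin p → ℝ) :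
    pderiv i φ θ = lineDeriv ℝ φ θ (Pi.single i 1) := by
  have h : ∀ t : ℝ, θ + t • Pi.single i (1 : ℝ) = Function.update θ i (θ i + t) := by
    intro t
    funext j
    by_cases hj : j = i
    · subst hj; simp
    · simp [hj]
  simp only [lineDeriv, h, pderiv]
  rw [deriv_comp_const_add (f := fun t => φ (Function.update θ i t)), add_zero]

theorem pderiv_congr {p : ℕ} {i : Fin p} {φ χ : (Fin p → ℝ) → ℝ} {θ : Fin p → ℝ}
    (h : φ =ᶠ[𝓝 θ] χ) : pderiv i φ θ = pderiv i χ θ := by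
  have hc : Tendsto (fun t => Function.update θ i t) (𝓝 (θ i)) (𝓝 θ) := by
    have : Continuous fun t => Function.update θ i t := by fun_prop
    simpa using this.tendsto (θ i)
  exact EventuallyEq.deriv_eq (hc.eventually h)

/-- `measurable_lineDeriv` asks for a globally continuous function. Near each point of `Θ`, `q`
agrees with `q ∘ c`, where `c` clamps the coordinates to a closed ball (a cube) inside `Θ`;
countably many of the open balls cover `Θ`. -/
theorem aemeasurable_pderiv {p : ℕ} {Θ : Set (Fin p → ℝ)} (hΘ : IsOpen Θ)
    {q : (Fin p → ℝ) → ℝ} (hq : ContinuousOn q Θ) (i : Fin p) :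
    AEMeasurable (pderiv i q) (volume.restrict Θ) := by
  have hloc : ∀ x ∈ Θ, ∃ B ∈ 𝓝 x, MeasurableSet B ∧
      AEMeasurable (pderiv i q) (volume.restrict B) := by
    intro x hx
    obtain ⟨r, hr, hball⟩ := Metric.nhds_basis_closedBall.mem_iff.1 (hΘ.mem_nhds hx)
    let c : (Fin p → ℝ) → Fin p → ℝ := fun y j => max (x j - r) (min (x j + r) (y j))
    have hc : Continuous c := by fun_prop
    have hcΘ : ∀ y, c y ∈ Θ := by
      refine fun y => hball ?_
      rw [Metric.mem_closedBall, dist_pi_le_iff hr.le]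
      intro j
      rw [Real.dist_eq, abs_le]
      have h1 : x j - r ≤ c y j := le_max_left _ _
      have h2 : c y j ≤ x j + r := max_le (by linarith) (min_le_left _ _)
      constructor <;> linarith
    have hcc : Continuous fun y => q (c y) := hq.comp_continuous hc hcΘ
    refine ⟨Metric.ball x r, Metric.ball_mem_nhds x hr, measurableSet_ball, ?_⟩
    have hm : Measurable (pderiv i fun y => q (c y)) := by
      rw [funext (pderiv_eq_lineDeriv i fun y => q (c y))]
      exact measurable_lineDeriv hcc
    refine hm.aemeasurable.congr ((ae_restrict_iff' measurableSet_ball).2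
      (Eventually.of_forall fun y hy => pderiv_congr ?_))
    filter_upwards [Metric.isOpen_ball.mem_nhds hy] with z hz
    rw [Metric.mem_ball, dist_pi_lt_iff hr] at hz
    congr 1
    funext j
    have := abs_lt.1 (hz j)
    simp only [c]
    rw [min_eq_right (by linarith), max_eq_right (by linarith)]
  choose! B hB hBm hBq using hloc
  obtain ⟨t, htΘ, htc, hcov⟩ := TopologicalSpace.countable_cover_nhdsWithin
    (f := B) (s := Θ) fun x hx => mem_nhdsWithin_of_mem_nhds (hB x hx)
  have := htc.to_subtype
  have : AEMeasurable (pderiv i q) (volume.restrict (⋃ x : t, B x)) :=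
    aemeasurable_iUnion_iff.2 fun x => hBq x (htΘ x.2)
  rw [Set.biUnion_eq_iUnion] at hcov
  exact this.mono_measure (Measure.restrict_mono hcov le_rfl)

/-! ### The prior on the set where its density is positive -/

/-- The set of the points of `Θ` at which `q` is positive. -/
def posSet {p : ℕ} (Θ : Set (Fin p → ℝ)) (q : (Fin p → ℝ) → ℝ) : Set (Fin p → ℝ) :=
  {θ | θ ∈ Θ ∧ 0 < q θ}

section Prior

variable {p : ℕ} {Θ : Set (Fin p → ℝ)} {Q : Measure (Fin p → ℝ)} {q : (Fin p → ℝ) → ℝ}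

theorem posSet_subset : posSet Θ q ⊆ Θ := fun _ h => h.1

theorem isOpen_posSet (hΘ : IsOpen Θ) (hq : ContinuousOn q Θ) : IsOpen (posSet Θ q) :=
  hq.isOpen_inter_preimage hΘ isOpen_Ioi

/-- Two kinds of boundary points occur. At one inside `Θ`, `q` is zero and continuous; any other
lies on the boundary of `Θ`, where the decay is assumed. -/
theorem tendsto_zero_of_mem_frontier (hΘ : IsOpen Θ) (hq0 : ∀ θ ∈ Θ, 0 ≤ q θ)
    (hq : ContinuousOn q Θ) (hb : VanishesAtBoundary Θ q) (i : Fin p)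
    (v : {j : Fin p // j ≠ i} → ℝ) (b : ℝ)
    (hbf : b ∈ frontier {t | insertCoord i t v ∈ posSet Θ q}) :
    Tendsto (fun t => q (insertCoord i t v)) (𝓝[{t | insertCoord i t v ∈ posSet Θ q}] b)
      (𝓝 0) := by
  have hc := continuous_insertCoord i v
  have hopen : IsOpen {t | insertCoord i t v ∈ posSet Θ q} := (isOpen_posSet hΘ hq).preimage hc
  rw [frontier, hopen.interior_eq] at hbf
  have hcl : insertCoord i b v ∈ closure Θ :=
    closure_mono posSet_subset (hc.closure_preimage_subset _ hbf.1)
  by_cases hbΘ : insertCoord i b v ∈ Θ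
  · have h0 : q (insertCoord i b v) = 0 :=
      le_antisymm (not_lt.1 fun h => hbf.2 ⟨hbΘ, h⟩) (hq0 _ hbΘ)
    have h1 : ContinuousAt (fun t => q (insertCoord i t v)) b :=
      (hq.continuousAt (hΘ.mem_nhds hbΘ)).comp (f := fun t => insertCoord i t v) hc.continuousAt
    have h2 := h1.tendsto
    rw [h0] at h2
    exact h2.mono_left nhdsWithin_le_nhds
  · have h1 := hb i (insertCoord i b v) (by
      rw [frontier, hΘ.interior_eq]; exact ⟨hcl, hbΘ⟩)
    simp only [update_insertCoord, insertCoord_self] at h1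
    exact h1.mono_left (nhdsWithin_mono _ fun t ht => ht.1)

/-- Points with `q = 0` carry no prior mass, so all `Q`-integrals can be moved to `posSet Θ q`,
where division by `q` is harmless. The coercion from `ℝ≥0` is the form used by the `smul₀` lemmas
for densities. -/
theorem IsWellBehavedPrior.restrict_eq (hQ : IsWellBehavedPrior Θ Q q) (hΘ : IsOpen Θ)
    (hq : ContinuousOn q Θ) :
    Q.restrict Θ = (volume.restrict (posSet Θ q)).withDensity
      (fun θ => ((q θ).toNNReal : ℝ≥0∞)) := by
  have hD := (isOpen_posSet hΘ hq).measurableSet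
  conv_lhs => rw [hQ.density]
  rw [restrict_withDensity hΘ.measurableSet, Measure.restrict_restrict hΘ.measurableSet,
    Set.inter_self]
  rw [show volume.restrict (posSet Θ q) = (volume.restrict Θ).restrict (posSet Θ q) by
    rw [Measure.restrict_restrict hD, Set.inter_eq_left.2 posSet_subset],
    ← withDensity_indicator hD]
  refine withDensity_congr_ae ((ae_restrict_iff' hΘ.measurableSet).2
    (Eventually.of_forall fun θ hθ => ?_))
  by_cases h : θ ∈ posSet Θ q
  · rw [Set.indicator_of_mem h]; rfl
  · rw [Set.indicator_of_notMem h]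
    exact ENNReal.ofReal_eq_zero.2 (not_lt.1 fun h' => h ⟨hθ, h'⟩)

theorem aemeasurable_posSet (hΘ : IsOpen Θ) (hq : ContinuousOn q Θ) :
    AEMeasurable q (volume.restrict (posSet Θ q)) :=
  (hq.mono posSet_subset).aemeasurable (isOpen_posSet hΘ hq).measurableSet

theorem ae_posSet (hΘ : IsOpen Θ) (hq : ContinuousOn q Θ) :
    ∀ᵐ θ ∂volume.restrict (posSet Θ q), θ ∈ Θ ∧ 0 < q θ :=
  ae_restrict_mem (isOpen_posSet hΘ hq).measurableSet

theorem IsWellBehavedPrior.integrableOn_iff (hQ : IsWellBehavedPrior Θ Q q) (hΘ : IsOpen Θ)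
    (hq : ContinuousOn q Θ) {F : (Fin p → ℝ) → ℝ} :
    IntegrableOn F Θ Q ↔ IntegrableOn (fun θ => q θ * F θ) (posSet Θ q) := by
  rw [IntegrableOn, hQ.restrict_eq hΘ hq,
    integrable_withDensity_iff_integrable_smul₀ (aemeasurable_posSet hΘ hq).real_toNNReal]
  refine integrable_congr ?_
  filter_upwards [ae_posSet hΘ hq] with θ hθ
  rw [NNReal.smul_def, Real.coe_toNNReal _ hθ.2.le, smul_eq_mul]

theorem IsWellBehavedPrior.setIntegral_eq (hQ : IsWellBehavedPrior Θ Q q) (hΘ : IsOpen Θ)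
    (hq : ContinuousOn q Θ) (F : (Fin p → ℝ) → ℝ) :
    ∫ θ in Θ, F θ ∂Q = ∫ θ in posSet Θ q, q θ * F θ := by
  rw [hQ.restrict_eq hΘ hq,
    integral_withDensity_eq_integral_smul₀ (aemeasurable_posSet hΘ hq).real_toNNReal]
  refine integral_congr_ae ?_
  filter_upwards [ae_posSet hΘ hq] with θ hθ
  rw [NNReal.smul_def, Real.coe_toNNReal _ hθ.2.le, smul_eq_mul]

/-- On `posSet Θ q` the density is positive, so there Lebesgue measure is absolutely continuous with
respect to `Q`. -/
theorem IsWellBehavedPrior.aestronglyMeasurable (hQ : IsWellBehavedPrior Θ Q q) (hΘ : IsOpen Θ)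
    (hq : ContinuousOn q Θ) {F : (Fin p → ℝ) → ℝ} (hF : AEStronglyMeasurable F (Q.restrict Θ)) :
    AEStronglyMeasurable F (volume.restrict (posSet Θ q)) := by
  refine hF.mono_ac ?_
  rw [hQ.restrict_eq hΘ hq]
  refine withDensity_absolutelyContinuous'
    (aemeasurable_posSet hΘ hq).real_toNNReal.coe_nnreal_ennreal ?_
  filter_upwards [ae_posSet hΘ hq] with θ hθ
  simpa using hθ.2

theorem IsWellBehavedPrior.integrableOn_posSet (hQ : IsWellBehavedPrior Θ Q q) (hΘ : IsOpen Θ)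
    (hq : ContinuousOn q Θ) : IntegrableOn q (posSet Θ q) := by
  have := hQ.prob
  have : IntegrableOn (fun _ => (1 : ℝ)) Θ Q := (integrable_const 1).integrableOn
  simpa using (hQ.integrableOn_iff hΘ hq).1 this

theorem IsWellBehavedPrior.setIntegral_posSet (hQ : IsWellBehavedPrior Θ Q q) (hΘ : IsOpen Θ)
    (hq : ContinuousOn q Θ) : ∫ θ in posSet Θ q, q θ = 1 := by
  have := hQ.prob
  have h1 : Q.restrict Θ = Q := by
    conv_lhs => rw [hQ.density]
    rw [restrict_withDensity hΘ.measurableSet, Measure.restrict_restrict hΘ.measurableSet,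
      Set.inter_self, ← hQ.density]
  have := hQ.setIntegral_eq hΘ hq fun _ => 1
  rw [h1] at this
  simpa using this.symm

theorem aemeasurable_pderiv_posSet (hΘ : IsOpen Θ) (hq : ContinuousOn q Θ) (i : Fin p) :
    AEMeasurable (pderiv i q) (volume.restrict (posSet Θ q)) :=
  (aemeasurable_pderiv hΘ hq i).mono_measure (Measure.restrict_mono posSet_subset le_rfl)

theorem IsWellBehavedPrior.integrableOn_sq_div (hQ : IsWellBehavedPrior Θ Q q) (hΘ : IsOpen Θ)
    (hq : ContinuousOn q Θ) (i : Fin p) :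
    IntegrableOn (fun θ => pderiv i q θ ^ 2 / q θ) (posSet Θ q) := by
  refine (hQ.integrable.mono_set posSet_subset).mono'
    (((aemeasurable_pderiv_posSet hΘ hq i).pow_const 2).div
      (aemeasurable_posSet hΘ hq)).aestronglyMeasurable ?_
  filter_upwards [ae_posSet hΘ hq] with θ hθ
  have h1 : θ ∈ {η | 0 < q η} := hθ.2
  rw [Real.norm_of_nonneg (div_nonneg (sq_nonneg _) hθ.2.le), Set.indicator_of_mem h1,
    Pi.one_apply, mul_one_div]
  refine div_le_div_of_nonneg_right ?_ hθ.2.le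
  exact Finset.single_le_sum (f := fun i => pderiv i q θ ^ 2) (fun _ _ => sq_nonneg _)
    (Finset.mem_univ i)

theorem IsWellBehavedPrior.integrableOn_mul_div (hQ : IsWellBehavedPrior Θ Q q) (hΘ : IsOpen Θ)
    (hq : ContinuousOn q Θ) (i k : Fin p) :
    IntegrableOn (fun θ => pderiv i q θ * pderiv k q θ / q θ) (posSet Θ q) := by
  refine ((hQ.integrableOn_sq_div hΘ hq i).add (hQ.integrableOn_sq_div hΘ hq k)).mono'
    (((aemeasurable_pderiv_posSet hΘ hq i).mul (aemeasurable_pderiv_posSet hΘ hq k)).div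
      (aemeasurable_posSet hΘ hq)).aestronglyMeasurable ?_
  filter_upwards [ae_posSet hΘ hq] with θ hθ
  rw [Pi.add_apply, ← add_div, norm_div, Real.norm_of_nonneg hθ.2.le]
  refine div_le_div_of_nonneg_right ?_ hθ.2.le
  rw [Real.norm_eq_abs, abs_le]
  constructor <;> nlinarith [sq_nonneg (pderiv i q θ - pderiv k q θ),
    sq_nonneg (pderiv i q θ + pderiv k q θ), sq_nonneg (pderiv i q θ), sq_nonneg (pderiv k q θ)]

/-- A weighted arithmetic-geometric mean inequality. -/
theorem abs_mul_le_sq_div_add {a b c : ℝ} (hb : 0 < b) : |a * c| ≤ a ^ 2 / b + b * c ^ 2 := by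
  have h : a ^ 2 / b + b * c ^ 2 - |a * c| =
      (|a| - b * |c|) ^ 2 / b + |a * c| := by
    rw [abs_mul]
    field_simp
    rw [sub_sq, mul_pow, sq_abs, sq_abs]
    ring
  have h2 : 0 ≤ (|a| - b * |c|) ^ 2 / b + |a * c| := by positivity
  linarith

/-- The domination is `|∂ᵢq F| ≤ (∂ᵢq)²/q + q F²`; with `F = 1` it gives integrability of `∂ᵢq`
itself from finite prior information. -/
theorem IsWellBehavedPrior.integrableOn_pderiv_mul (hQ : IsWellBehavedPrior Θ Q q)
    (hΘ : IsOpen Θ) (hq : ContinuousOn q Θ) (i : Fin p) {F : (Fin p → ℝ) → ℝ}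
    (hF : AEStronglyMeasurable F (volume.restrict (posSet Θ q)))
    (hF2 : IntegrableOn (fun θ => q θ * F θ ^ 2) (posSet Θ q)) :
    IntegrableOn (fun θ => pderiv i q θ * F θ) (posSet Θ q) := by
  refine ((hQ.integrableOn_sq_div hΘ hq i).add hF2).mono'
    ((aemeasurable_pderiv_posSet hΘ hq i).aestronglyMeasurable.mul hF) ?_
  filter_upwards [ae_posSet hΘ hq] with θ hθ
  exact abs_mul_le_sq_div_add hθ.2

theorem IsWellBehavedPrior.integrableOn_pderiv (hQ : IsWellBehavedPrior Θ Q q)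
    (hΘ : IsOpen Θ) (hq : ContinuousOn q Θ) (i : Fin p) :
    IntegrableOn (pderiv i q) (posSet Θ q) := by
  simpa using hQ.integrableOn_pderiv_mul hΘ hq i (F := fun _ => 1) aestronglyMeasurable_const
    (by simpa using hQ.integrableOn_posSet hΘ hq)

theorem fisherPrior_apply (hΘ : IsOpen Θ) (hq : ContinuousOn q Θ) (i k : Fin p) :
    fisherPrior Θ q i k = ∫ θ in posSet Θ q, pderiv i q θ * pderiv k q θ / q θ := by
  rw [fisherPrior, Matrix.of_apply, ← integral_indicator hΘ.measurableSet,
    ← integral_indicator (isOpen_posSet hΘ hq).measurableSet]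
  refine integral_congr_ae (Eventually.of_forall fun θ => ?_)
  by_cases h1 : θ ∈ Θ <;> by_cases h2 : 0 < q θ <;>
    simp [Set.indicator, posSet, h1, h2, div_eq_mul_inv]

/-- Integration by parts in one coordinate of a bounded function against the prior density. -/
theorem IsWellBehavedPrior.setIntegral_mul_add_mul_pderiv (hQ : IsWellBehavedPrior Θ Q q)
    (hΘ : IsOpen Θ) (hq : ContinuousOn q Θ) (hb : VanishesAtBoundary Θ q) (i : Fin p)
    {φ φ' : (Fin p → ℝ) → ℝ} {C : ℝ}
    (hφ : ∀ᵐ v : {j : Fin p // j ≠ i} → ℝ,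
      AbsContOn {t | insertCoord i t v ∈ posSet Θ q} fun t => φ (insertCoord i t v))
    (hφC : ∀ θ ∈ posSet Θ q, |φ θ| ≤ C)
    (hφm : AEStronglyMeasurable φ (volume.restrict (posSet Θ q)))
    (hφ' : ∀ᵐ v : {j : Fin p // j ≠ i} → ℝ, ∀ᵐ t : ℝ, insertCoord i t v ∈ posSet Θ q →
      deriv (fun t => φ (insertCoord i t v)) t = φ' (insertCoord i t v))
    (hφd : IntegrableOn (fun θ => φ' θ * q θ) (posSet Θ q)) :
    ∫ θ in posSet Θ q, (φ' θ * q θ + φ θ * pderiv i q θ) = 0 :=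
  setIntegral_mul_add_mul_pderiv_eq_zero i (isOpen_posSet hΘ hq)
    ((hQ.nice.mono posSet_subset) i) hφ
    (tendsto_zero_of_mem_frontier hΘ hQ.nonneg hq hb i)
    (fun _ h => h.2.le) hφC hφm (hQ.integrableOn_posSet hΘ hq)
    (hQ.integrableOn_pderiv hΘ hq i) hφ' hφd

end Prior

/-! ### Square integrable functions -/

section L2

variable {X : Type*} [MeasurableSpace X] {μ : Measure X}

open Classical in
/-- The class in `L²(μ)` of a square integrable function. -/
noncomputable def toL2 (μ : Measure X) (u : X → ℝ) : Lp ℝ 2 μ :=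
  if h : MemLp u 2 μ then h.toLp u else 0

theorem toL2_eq {u : X → ℝ} (hu : MemLp u 2 μ) : toL2 μ u = hu.toLp u := dif_pos hu

theorem inner_toL2 {u v : X → ℝ} (hu : MemLp u 2 μ) (hv : MemLp v 2 μ) :
    inner ℝ (toL2 μ u) (toL2 μ v) = ∫ x, u x * v x ∂μ := by
  rw [toL2_eq hu, toL2_eq hv, L2.inner_def]
  refine integral_congr_ae ?_
  filter_upwards [hu.coeFn_toLp, hv.coeFn_toLp] with x h1 h2
  rw [h1, h2]
  simp [mul_comm]

theorem toL2_sub {u v : X → ℝ} (hu : MemLp u 2 μ) (hv : MemLp v 2 μ) :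
    toL2 μ u - toL2 μ v = toL2 μ fun x => u x - v x := by
  have h : MemLp (fun x => u x - v x) 2 μ := hu.sub hv
  rw [toL2_eq hu, toL2_eq hv, toL2_eq h, ← MemLp.toLp_sub]
  rfl

theorem smul_toL2 {u : X → ℝ} (hu : MemLp u 2 μ) (c : ℝ) :
    c • toL2 μ u = toL2 μ fun x => c * u x := by
  rw [toL2_eq hu, toL2_eq (hu.const_mul c), ← MemLp.toLp_const_smul]
  rfl

theorem norm_toL2 {u : X → ℝ} (hu : MemLp u 2 μ) : ‖toL2 μ u‖ = l2norm μ u := by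
  rw [l2norm, ← Real.sqrt_sq (norm_nonneg (toL2 μ u)), ← real_inner_self_eq_norm_sq,
    inner_toL2 hu hu]
  simp only [sq]

theorem memLp_bdd_mul {T u : X → ℝ} {C : ℝ} (hT : Measurable T) (hC : ∀ x, |T x| ≤ C)
    (hu : MemLp u 2 μ) : MemLp (fun x => T x * u x) 2 μ :=
  hu.of_le_mul (c := C) (hT.aestronglyMeasurable.mul hu.1) (Eventually.of_forall fun x => by
    rw [norm_mul]
    exact mul_le_mul_of_nonneg_right (hC x) (norm_nonneg _))

theorem l2norm_bdd_mul_le {T u : X → ℝ} {C : ℝ} (hC0 : 0 ≤ C) (hC : ∀ x, |T x| ≤ C)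
    (hu : MemLp u 2 μ) : l2norm μ (fun x => T x * u x) ≤ C * l2norm μ u := by
  rw [l2norm, l2norm, ← Real.sqrt_sq hC0, ← Real.sqrt_mul (sq_nonneg C), ← integral_const_mul]
  refine Real.sqrt_le_sqrt (integral_mono_of_nonneg (Eventually.of_forall fun x => sq_nonneg _)
    (hu.integrable_sq.const_mul _) (Eventually.of_forall fun x => ?_))
  simp only [mul_pow]
  exact mul_le_mul_of_nonneg_right (sq_le_sq' (abs_le.1 (hC x)).1 (abs_le.1 (hC x)).2)
    (sq_nonneg _)

theorem two_mul_abs_integral_mul_le {u v : X → ℝ} (hu : MemLp u 2 μ) (hv : MemLp v 2 μ) :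
    2 * |∫ x, u x * v x ∂μ| ≤ (∫ x, u x ^ 2 ∂μ) + ∫ x, v x ^ 2 ∂μ := by
  rw [← inner_toL2 hu hv]
  have hu2 : ∫ x, u x ^ 2 ∂μ = ‖toL2 μ u‖ ^ 2 := by
    rw [← real_inner_self_eq_norm_sq, inner_toL2 hu hu]
    simp only [sq]
  have hv2 : ∫ x, v x ^ 2 ∂μ = ‖toL2 μ v‖ ^ 2 := by
    rw [← real_inner_self_eq_norm_sq, inner_toL2 hv hv]
    simp only [sq]
  rw [hu2, hv2]
  nlinarith [abs_real_inner_le_norm (toL2 μ u) (toL2 μ v),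
    sq_nonneg (‖toL2 μ u‖ - ‖toL2 μ v‖)]

end L2

/-! ### Differentiating expectations under the model -/

section Model

variable {p : ℕ} {X : Type*} [MeasurableSpace X] {μ : Measure X}
  {Θ D : Set (Fin p → ℝ)} {f : (Fin p → ℝ) → X → ℝ}

/-- A jointly measurable family of nonnegative functions that are probability densities with
respect to `μ` for the parameters in `Θ`. -/
structure IsModel (μ : Measure X) (Θ : Set (Fin p → ℝ)) (f : (Fin p → ℝ) → X → ℝ) : Prop where
  meas : Measurable (Function.uncurry f)
  nonneg : ∀ θ x, 0 ≤ f θ x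
  lintegral : ∀ θ ∈ Θ, ∫⁻ x, ENNReal.ofReal (f θ x) ∂μ = 1

theorem IsModel.measurable (hf : IsModel μ Θ f) (θ : Fin p → ℝ) : Measurable (f θ) :=
  hf.meas.comp measurable_prodMk_left

theorem IsModel.integrable (hf : IsModel μ Θ f) {θ : Fin p → ℝ} (hθ : θ ∈ Θ) :
    Integrable (f θ) μ := by
  refine ⟨(hf.measurable θ).aestronglyMeasurable, ?_⟩
  rw [hasFiniteIntegral_iff_ofReal (Eventually.of_forall (hf.nonneg θ)), hf.lintegral θ hθ]
  exact ENNReal.one_lt_top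

theorem IsModel.integral (hf : IsModel μ Θ f) {θ : Fin p → ℝ} (hθ : θ ∈ Θ) :
    ∫ x, f θ x ∂μ = 1 := by
  rw [integral_eq_lintegral_of_nonneg_ae (Eventually.of_forall (hf.nonneg θ))
    (hf.measurable θ).aestronglyMeasurable, hf.lintegral θ hθ, ENNReal.toReal_one]

theorem IsModel.memLp_mul_sqrt (hf : IsModel μ Θ f) {T : X → ℝ} (hT : Measurable T)
    {θ : Fin p → ℝ} (hi : Integrable (fun x => T x ^ 2 * f θ x) μ) :
    MemLp (fun x => T x * √(f θ x)) 2 μ := by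
  have hm : Measurable fun x => T x * √(f θ x) := hT.mul (hf.measurable θ).sqrt
  rw [memLp_two_iff_integrable_sq hm.aestronglyMeasurable]
  refine hi.congr (Eventually.of_forall fun x => ?_)
  simp only [mul_pow, Real.sq_sqrt (hf.nonneg θ x)]

theorem IsModel.memLp_sqrt (hf : IsModel μ Θ f) {θ : Fin p → ℝ} (hθ : θ ∈ Θ) :
    MemLp (fun x => √(f θ x)) 2 μ := by
  simpa using hf.memLp_mul_sqrt (T := fun _ => 1) measurable_const
    (by simpa using hf.integrable hθ)

theorem eventually_update_mem (hΘ : IsOpen Θ) {θ : Fin p → ℝ} (hθ : θ ∈ Θ) (i : Fin p) :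
    ∀ᶠ t in 𝓝 (θ i), Function.update θ i t ∈ Θ := by
  have hc : Continuous fun t => Function.update θ i t := by fun_prop
  refine hc.continuousAt.eventually (hΘ.mem_nhds ?_)
  simpa using hθ

/-- Multiplication by a bounded `T` is a bounded operator on `L²(μ)`, so it preserves the first
order expansion. The value `0` of `toL2` outside `L²(μ)` does no harm, since `Θ` is open and only
`t` near `θ i` matter. -/
theorem IsModel.hasDerivAt_toL2 (hf : IsModel μ Θ f) (hΘ : IsOpen Θ) {θ : Fin p → ℝ}
    (hθ : θ ∈ Θ) {i : Fin p} {g : X → ℝ} (hg : IsL2PartialDeriv μ f θ i g) {T : X → ℝ} {C : ℝ}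
    (hT : Measurable T) (hC : ∀ x, |T x| ≤ C) :
    HasDerivAt (fun t => toL2 μ fun x => T x * √(f (Function.update θ i t) x))
      (toL2 μ fun x => T x * g x) (θ i) := by
  rw [hasDerivAt_iff_isLittleO]
  refine IsBigO.trans_isLittleO (IsBigO.of_bound |C| ?_) hg.2
  filter_upwards [eventually_update_mem hΘ hθ i] with t ht
  have h1 := hf.memLp_sqrt ht
  have h2 := hf.memLp_sqrt hθ
  have h3 := hg.1.const_mul (t - θ i)
  have hC' : ∀ x, |T x| ≤ |C| := fun x => (hC x).trans (le_abs_self C)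
  have h5 : MemLp (fun x => T x * √(f (Function.update θ i t) x) - T x * √(f θ x)) 2 μ :=
    (memLp_bdd_mul hT hC h1).sub (memLp_bdd_mul hT hC h2)
  rw [Function.update_eq_self, toL2_sub (memLp_bdd_mul hT hC h1) (memLp_bdd_mul hT hC h2),
    smul_toL2 (memLp_bdd_mul hT hC hg.1),
    toL2_sub h5 ((memLp_bdd_mul hT hC hg.1).const_mul _)]
  have he : (fun x => T x * √(f (Function.update θ i t) x) - T x * √(f θ x) -
      (t - θ i) * (T x * g x)) = fun x => T x *
        (√(f (Function.update θ i t) x) - √(f θ x) - (t - θ i) * g x) := by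
    funext x; ring
  have h4 : MemLp (fun x => √(f (Function.update θ i t) x) - √(f θ x) - (t - θ i) * g x) 2 μ :=
    (h1.sub h2).sub h3
  rw [he, norm_toL2 (memLp_bdd_mul hT hC h4)]
  exact (l2norm_bdd_mul_le (abs_nonneg C) hC' h4).trans
    (mul_le_mul_of_nonneg_left (le_abs_self _) (abs_nonneg C))

/-- Write the expectation as the inner product of `√f` and `T √f`. The two terms of the product rule
coincide, whence the factor `2`. -/
theorem IsModel.hasDerivAt_integral (hf : IsModel μ Θ f) (hΘ : IsOpen Θ) {θ : Fin p → ℝ}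
    (hθ : θ ∈ Θ) {i : Fin p} {g : X → ℝ} (hg : IsL2PartialDeriv μ f θ i g) {T : X → ℝ} {C : ℝ}
    (hT : Measurable T) (hC : ∀ x, |T x| ≤ C) :
    HasDerivAt (fun t => ∫ x, T x * f (Function.update θ i t) x ∂μ)
      (2 * ∫ x, T x * (√(f θ x) * g x) ∂μ) (θ i) := by
  have h1 : ∀ x : X, |(fun _ => (1 : ℝ)) x| ≤ 1 := fun x => by simp
  have hA := hf.hasDerivAt_toL2 hΘ hθ hg measurable_const h1
  have hB := hf.hasDerivAt_toL2 hΘ hθ hg hT hC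
  have hξ := hf.memLp_sqrt hθ
  have hAB := hA.inner ℝ hB
  simp only [one_mul, Function.update_eq_self] at hAB
  rw [inner_toL2 hξ (memLp_bdd_mul hT hC hg.1), inner_toL2 hg.1 (memLp_bdd_mul hT hC hξ)] at hAB
  have he : 2 * ∫ x, T x * (√(f θ x) * g x) ∂μ =
      (∫ x, √(f θ x) * (T x * g x) ∂μ) + ∫ x, g x * (T x * √(f θ x)) ∂μ := by
    rw [two_mul]
    congr 1 <;> exact integral_congr_ae (Eventually.of_forall fun x => by ring)
  rw [he]
  refine hAB.congr_of_eventuallyEq ?_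
  filter_upwards [eventually_update_mem hΘ hθ i] with t ht
  have hξt := hf.memLp_sqrt ht
  rw [inner_toL2 hξt (memLp_bdd_mul hT hC hξt)]
  refine integral_congr_ae (Eventually.of_forall fun x => ?_)
  have := Real.mul_self_sqrt (hf.nonneg (Function.update θ i t) x)
  calc T x * f (Function.update θ i t) x
      = T x * (√(f (Function.update θ i t) x) * √(f (Function.update θ i t) x)) := by rw [this]
    _ = _ := by ring

/-- Scores have mean zero. -/
theorem IsModel.integral_sqrt_mul_eq_zero (hf : IsModel μ Θ f) (hΘ : IsOpen Θ)
    {θ : Fin p → ℝ} (hθ : θ ∈ Θ) {i : Fin p} {g : X → ℝ} (hg : IsL2PartialDeriv μ f θ i g) :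
    ∫ x, √(f θ x) * g x ∂μ = 0 := by
  have h := hf.hasDerivAt_integral hΘ hθ hg (T := fun _ => 1) (C := 1) measurable_const
    fun x => by simp
  have h2 : HasDerivAt (fun t => ∫ x, 1 * f (Function.update θ i t) x ∂μ) 0 (θ i) := by
    refine (hasDerivAt_const (θ i) (1 : ℝ)).congr_of_eventuallyEq ?_
    filter_upwards [eventually_update_mem hΘ hθ i] with t ht
    simp only [one_mul]
    exact hf.integral ht
  have h3 := h.unique h2
  simpa using h3

variable [SigmaFinite μ]

theorem measurable_update_add (i : Fin p) (c : ℝ) :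
    Measurable fun θ : Fin p → ℝ => Function.update θ i (θ i + c) := by
  have : Continuous fun θ : Fin p → ℝ => Function.update θ i (θ i + c) := by fun_prop
  exact this.measurable

theorem IsModel.stronglyMeasurable_integral (hf : IsModel μ Θ f) {T : X → ℝ}
    (hT : Measurable T) : StronglyMeasurable fun θ => ∫ x, T x * f θ x ∂μ :=
  StronglyMeasurable.integral_prod_right'
    (f := fun z : (Fin p → ℝ) × X => T z.2 * f z.1 z.2)
    ((hT.comp measurable_snd).mul hf.meas).stronglyMeasurable

/-- Exhibits a derivative as a limit of a sequence, as limit theorems for measurability require. -/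
theorem tendsto_slope_seq {E : Type*} [NormedAddCommGroup E] [NormedSpace ℝ E] {F : ℝ → E}
    {F' : E} {a : ℝ} (h : HasDerivAt F F' a) :
    Tendsto (fun n : ℕ => (1 / ((n : ℝ) + 1))⁻¹ • (F (a + 1 / ((n : ℝ) + 1)) - F a)) atTop
      (𝓝 F') := by
  have h1 := hasDerivAt_iff_tendsto_slope_zero.1 h
  refine h1.comp (tendsto_nhdsWithin_iff.2
    ⟨tendsto_one_div_add_atTop_nhds_zero_nat, Eventually.of_forall fun n => ?_⟩)
  have : (0 : ℝ) < 1 / ((n : ℝ) + 1) := by positivity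
  exact this.ne'

theorem tendsto_add_one_div (a : ℝ) :
    Tendsto (fun n : ℕ => a + 1 / ((n : ℝ) + 1)) atTop (𝓝 a) := by
  simpa using tendsto_one_div_add_atTop_nhds_zero_nat.const_add a

/-- The entries of the Fisher information of the model are measurable. -/
theorem IsModel.aestronglyMeasurable_fisher (hf : IsModel μ Θ f) (hΘ : IsOpen Θ) (hDΘ : D ⊆ Θ)
    (hD : MeasurableSet D) {i k : Fin p} {ξ' : (Fin p → ℝ) → Fin p → X → ℝ}
    (hξ : ∀ θ ∈ D, ∀ i, IsL2PartialDeriv μ f θ i (ξ' θ i)) :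
    AEStronglyMeasurable (fun θ => ∫ x, ξ' θ i x * ξ' θ k x ∂μ) (volume.restrict D) := by
  -- No joint measurability of `ξ'` in `(θ, x)` is assumed. The difference quotients of `√f` are
  -- jointly measurable, and their inner products converge to those of `ξ'`.
  let A : ℕ → Fin p → (Fin p → ℝ) → X → ℝ := fun n i θ x =>
    (1 / ((n : ℝ) + 1))⁻¹ *
      (√(f (Function.update θ i (θ i + 1 / ((n : ℝ) + 1))) x) - √(f θ x))
  have hAm : ∀ n i, Measurable (Function.uncurry (A n i)) := by
    intro n i
    have h1 : Measurable fun z : (Fin p → ℝ) × X =>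
        f (Function.update z.1 i (z.1 i + 1 / ((n : ℝ) + 1))) z.2 :=
      hf.meas.comp (((measurable_update_add i _).comp measurable_fst).prodMk measurable_snd)
    exact (h1.sqrt.sub hf.meas.sqrt).const_mul _
  refine aestronglyMeasurable_of_tendsto_ae atTop
    (f := fun n : ℕ => fun θ => ∫ x, A n i θ x * A n k θ x ∂μ) (fun n => ?_) ?_
  · exact (StronglyMeasurable.integral_prod_right'
      (f := fun z : (Fin p → ℝ) × X => A n i z.1 z.2 * A n k z.1 z.2)
      ((hAm n i).mul (hAm n k)).stronglyMeasurable).aestronglyMeasurable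
  filter_upwards [ae_restrict_mem hD] with θ hθ
  have hlim : ∀ i, Tendsto (fun n : ℕ => toL2 μ (A n i θ)) atTop (𝓝 (toL2 μ (ξ' θ i))) ∧
      ∀ᶠ n : ℕ in atTop, MemLp (A n i θ) 2 μ := by
    intro i
    have hd := hf.hasDerivAt_toL2 hΘ (hDΘ hθ) (hξ θ hθ i) (T := fun _ => 1) (C := 1)
      measurable_const fun x => by simp
    simp only [one_mul] at hd
    have hev : ∀ᶠ n : ℕ in atTop, Function.update θ i (θ i + 1 / ((n : ℝ) + 1)) ∈ Θ :=
      (tendsto_add_one_div (θ i)).eventually (eventually_update_mem hΘ (hDΘ hθ) i)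
    constructor
    · refine (tendsto_slope_seq hd).congr' ?_
      filter_upwards [hev] with n hn
      have h1 : MemLp (fun x => √(f (Function.update θ i (θ i + 1 / ((n : ℝ) + 1))) x) -
          √(f θ x)) 2 μ := (hf.memLp_sqrt hn).sub (hf.memLp_sqrt (hDΘ hθ))
      rw [Function.update_eq_self, toL2_sub (hf.memLp_sqrt hn) (hf.memLp_sqrt (hDΘ hθ)),
        smul_toL2 h1]
    · filter_upwards [hev] with n hn
      exact ((hf.memLp_sqrt hn).sub (hf.memLp_sqrt (hDΘ hθ))).const_mul _
  have h := (hlim i).1.inner (𝕜 := ℝ) (hlim k).1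
  rw [inner_toL2 (hξ θ hθ i).1 (hξ θ hθ k).1] at h
  refine h.congr' ?_
  filter_upwards [(hlim i).2, (hlim k).2] with n h1 h2
  exact inner_toL2 h1 h2

/-- At each point of `D` this is the derivative of a measurable function of `θ`, hence a limit of
measurable difference quotients; again `ξ'` need not be jointly measurable. -/
theorem IsModel.aestronglyMeasurable_integral_mul_of_bounded (hf : IsModel μ Θ f)
    (hΘ : IsOpen Θ) (hDΘ : D ⊆ Θ) (hD : MeasurableSet D) {i : Fin p}
    {ξ' : (Fin p → ℝ) → Fin p → X → ℝ}
    (hξ : ∀ θ ∈ D, ∀ i, IsL2PartialDeriv μ f θ i (ξ' θ i)) {T : X → ℝ} {C : ℝ}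
    (hT : Measurable T) (hC : ∀ x, |T x| ≤ C) :
    AEStronglyMeasurable (fun θ => 2 * ∫ x, T x * (√(f θ x) * ξ' θ i x) ∂μ)
      (volume.restrict D) := by
  have hm := (hf.stronglyMeasurable_integral hT).measurable
  refine aestronglyMeasurable_of_tendsto_ae atTop
    (f := fun n : ℕ => fun θ => (1 / ((n : ℝ) + 1))⁻¹ •
      ((∫ x, T x * f (Function.update θ i (θ i + 1 / ((n : ℝ) + 1))) x ∂μ) -
        ∫ x, T x * f θ x ∂μ)) (fun n => ?_) ?_
  · have h := ((hm.comp (measurable_update_add i (1 / ((n : ℝ) + 1)))).sub hm).const_mul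
      (1 / ((n : ℝ) + 1))⁻¹
    exact h.aestronglyMeasurable
  filter_upwards [ae_restrict_mem hD] with θ hθ
  have := tendsto_slope_seq (hf.hasDerivAt_integral hΘ (hDΘ hθ) (hξ θ hθ i) hT hC)
  simpa only [Function.update_eq_self] using this

end Model

/-! ### Integration by parts of nice functions, and nondegeneracy of the prior -/

/-- On compact intervals `q` is bounded away from zero, so `h'` is integrable there. Since `h` is
differentiable at every point, and not just almost everywhere, it is then an indefinite integral of
`h'`. -/
theorem absContOn_of_hasDerivAt {U : Set ℝ} {h h' q : ℝ → ℝ}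
    (hd : ∀ t ∈ U, HasDerivAt h (h' t) t) (hq : ContinuousOn q U) (hq0 : ∀ t ∈ U, 0 < q t)
    (hi : IntegrableOn (fun t => h' t * q t) U) : AbsContOn U h := by
  intro a b hab hs
  have h1 : IntegrableOn h' (Set.Icc a b) := by
    have h2 := (hi.mono_set hs).mul_continuousOn
      ((hq.mono hs).inv₀ fun t ht => (hq0 t (hs ht)).ne') isCompact_Icc
    refine h2.congr_fun (fun t ht => ?_) measurableSet_Icc
    exact mul_inv_cancel_right₀ (hq0 t (hs ht)).ne' _
  have h3 : IntervalIntegrable h' volume a b :=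
    (intervalIntegrable_iff_integrableOn_Icc_of_le hab).2 h1
  refine absolutelyContinuousOnInterval_of_dist_le (C := 1)
    (h3.absolutelyContinuousOnInterval_intervalIntegral (c := a) Set.left_mem_uIcc) ?_
  intro x hx y hy
  have key : ∀ z ∈ Set.uIcc a b, ∫ t in a..z, h' t = h z - h a := by
    intro z hz
    have hsub : Set.uIcc a z ⊆ Set.uIcc a b := Set.uIcc_subset_uIcc_left hz
    refine intervalIntegral.integral_eq_sub_of_hasDerivAt (fun t ht => hd t (hs ?_))
      (h3.mono_set hsub)
    rw [← Set.uIcc_of_le hab]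
    exact hsub ht
  rw [key x hx, key y hy, one_mul, dist_sub_right]

theorem abs_arctan_sub_le (x y : ℝ) : |Real.arctan x - Real.arctan y| ≤ |x - y| := by
  have h := Convex.norm_image_sub_le_of_norm_deriv_le (f := Real.arctan) (C := 1)
    (s := Set.univ) (x := y) (y := x) (fun t _ => Real.differentiableAt_arctan t)
    (fun t _ => by
      rw [Real.deriv_arctan, Real.norm_of_nonneg (by positivity)]
      exact div_le_one_of_le₀ (by nlinarith [sq_nonneg t]) (by positivity))
    convex_univ (Set.mem_univ _) (Set.mem_univ _)
  simpa using h

theorem abs_arctan_le (x : ℝ) : |Real.arctan x| ≤ Real.pi / 2 :=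
  abs_le.2 ⟨(Real.neg_pi_div_two_lt_arctan x).le, (Real.arctan_lt_pi_div_two x).le⟩

section Prior

variable {p : ℕ} {Θ : Set (Fin p → ℝ)} {Q : Measure (Fin p → ℝ)} {q : (Fin p → ℝ) → ℝ}

/-- Integration by parts in one coordinate of a nice function against the prior density. -/
theorem IsWellBehavedPrior.setIntegral_pderiv_mul_add (hQ : IsWellBehavedPrior Θ Q q)
    (hΘ : IsOpen Θ) (hq : ContinuousOn q Θ) (hb : VanishesAtBoundary Θ q) (i : Fin p)
    {ψ : (Fin p → ℝ) → ℝ} (hψ : NiceOn Θ ψ)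
    (hψm : AEStronglyMeasurable ψ (volume.restrict (posSet Θ q)))
    (hψ2 : IntegrableOn (fun θ => q θ * ψ θ ^ 2) (posSet Θ q))
    (hψd : IntegrableOn (fun θ => q θ * pderiv i ψ θ) (posSet Θ q)) :
    ∫ θ in posSet Θ q, (pderiv i ψ θ * q θ + ψ θ * pderiv i q θ) = 0 := by
  have hD := isOpen_posSet hΘ hq
  have hqm := aemeasurable_posSet hΘ hq
  -- Continuity of `ψ` is not available, so measurability of its derivative is recovered from that
  -- of `q * ∂ᵢψ` by division.
  have hdm : AEMeasurable (pderiv i ψ) (volume.restrict (posSet Θ q)) := by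
    refine (hψd.1.aemeasurable.div hqm).congr ?_
    filter_upwards [ae_posSet hΘ hq] with θ hθ
    simp only [Pi.div_apply]
    rw [mul_div_cancel_left₀ _ hθ.2.ne']
  -- The smooth truncation `arctan (c ψ) / c` is bounded and dominated by `ψ`, its derivative `∂ᵢψ /
  -- (1 + (c ψ)²)` is dominated by `∂ᵢψ`, and both converge as `c → 0`.
  let c : ℕ → ℝ := fun n => 1 / ((n : ℝ) + 1)
  have hc : ∀ n, 0 < c n := fun n => by positivity
  let φ : ℕ → (Fin p → ℝ) → ℝ := fun n θ => (c n)⁻¹ * Real.arctan (c n * ψ θ)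
  let φ' : ℕ → (Fin p → ℝ) → ℝ := fun n θ => pderiv i ψ θ / (1 + (c n * ψ θ) ^ 2)
  have hφ'le : ∀ n θ, |φ' n θ| ≤ |pderiv i ψ θ| := by
    intro n θ
    rw [abs_div, abs_of_pos (show 0 < 1 + (c n * ψ θ) ^ 2 by positivity)]
    exact div_le_self (abs_nonneg _) (by nlinarith [sq_nonneg (c n * ψ θ)])
  have hφle : ∀ n θ, |φ n θ| ≤ |ψ θ| := by
    intro n θ
    have h := abs_arctan_sub_le (c n * ψ θ) 0
    rw [Real.arctan_zero, sub_zero, sub_zero, abs_mul, abs_of_pos (hc n)] at h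
    rw [abs_mul, abs_of_pos (inv_pos.2 (hc n)), inv_mul_le_iff₀ (hc n)]
    exact h
  have hφm : ∀ n, AEStronglyMeasurable (φ n) (volume.restrict (posSet Θ q)) := fun n =>
    ((Real.measurable_arctan.comp_aemeasurable
      (hψm.aemeasurable.const_mul (c n))).const_mul _).aestronglyMeasurable
  have hφ'm : ∀ n, AEMeasurable (φ' n) (volume.restrict (posSet Θ q)) := fun n =>
    hdm.div (((hψm.aemeasurable.const_mul (c n)).pow_const 2).const_add 1)
  have hzero : ∀ n, ∫ θ in posSet Θ q, (φ' n θ * q θ + φ n θ * pderiv i q θ) = 0 := by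
    intro n
    refine hQ.setIntegral_mul_add_mul_pderiv hΘ hq hb i (C := (c n)⁻¹ * (Real.pi / 2))
      ?_ ?_ (hφm n) ?_ ?_
    · filter_upwards [(hψ.mono (posSet_subset (q := q))) i] with v hv
      refine hv.comp_lipschitz (F := fun y => (c n)⁻¹ * Real.arctan (c n * y)) (C := 1)
        fun x y => ?_
      rw [← mul_sub, abs_mul, abs_of_pos (inv_pos.2 (hc n)), inv_mul_le_iff₀ (hc n), one_mul]
      refine (abs_arctan_sub_le _ _).trans_eq ?_
      rw [← mul_sub, abs_mul, abs_of_pos (hc n)]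
    · intro θ _
      rw [abs_mul, abs_of_pos (inv_pos.2 (hc n))]
      exact mul_le_mul_of_nonneg_left (abs_arctan_le _) (inv_pos.2 (hc n)).le
    · filter_upwards [(hψ.mono (posSet_subset (q := q))) i] with v hv
      filter_upwards [hv.ae_differentiableAt
        (hD.preimage (continuous_insertCoord i v))] with t ht htD
      have h := (((ht htD).hasDerivAt.const_mul (c n)).arctan).const_mul (c n)⁻¹
      refine h.deriv.trans ?_
      simp only [φ', pderiv_insertCoord]
      have := (hc n).ne'
      field_simp
    · refine Integrable.mono hψd ((hφ'm n).mul hqm).aestronglyMeasurable ?_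
      refine Eventually.of_forall fun θ => ?_
      simp only [norm_mul, Real.norm_eq_abs]
      rw [mul_comm]
      exact mul_le_mul_of_nonneg_left (hφ'le n θ) (abs_nonneg _)
  have hdom := hψd.norm.add (hQ.integrableOn_pderiv_mul hΘ hq i hψm hψ2).norm
  have hlim := tendsto_integral_of_dominated_convergence (μ := volume.restrict (posSet Θ q))
    (F := fun n θ => φ' n θ * q θ + φ n θ * pderiv i q θ)
    (f := fun θ => pderiv i ψ θ * q θ + ψ θ * pderiv i q θ) _
    (fun n => (((hφ'm n).mul hqm).add ((hφm n).aemeasurable.mul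
      (aemeasurable_pderiv_posSet hΘ hq i))).aestronglyMeasurable) hdom
    (fun n => Eventually.of_forall fun θ => by
      refine (norm_add_le _ _).trans (add_le_add ?_ ?_)
      · simp only [norm_mul, Real.norm_eq_abs]
        rw [mul_comm]
        exact mul_le_mul_of_nonneg_left (hφ'le n θ) (abs_nonneg _)
      · simp only [norm_mul, Real.norm_eq_abs]
        rw [mul_comm]
        exact mul_le_mul_of_nonneg_left (hφle n θ) (abs_nonneg _))
    (Eventually.of_forall fun θ => by
      have hc0 : Tendsto c atTop (𝓝 0) := tendsto_one_div_add_atTop_nhds_zero_nat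
      have h1 : Tendsto (fun n => φ' n θ) atTop (𝓝 (pderiv i ψ θ)) := by
        have h2 : Tendsto (fun n => 1 + (c n * ψ θ) ^ 2) atTop (𝓝 (1 + (0 * ψ θ) ^ 2)) :=
          ((hc0.mul_const _).pow 2).const_add 1
        have h3 := (tendsto_const_nhds (x := pderiv i ψ θ)).div h2 (by simp)
        rw [zero_mul, zero_pow two_ne_zero, add_zero, div_one] at h3
        exact h3
      have h4 : Tendsto (fun n => φ n θ) atTop (𝓝 (ψ θ)) := by
        -- `φ n θ` is the difference quotient of this function at `0` with step `c n`.
        have h5 : HasDerivAt (fun t => Real.arctan (t * ψ θ)) (ψ θ) 0 := by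
          have := ((hasDerivAt_id (0 : ℝ)).mul_const (ψ θ)).arctan
          simpa using this
        have h6 := tendsto_slope_seq h5
        simpa [φ, c] using h6
      exact (h1.mul_const _).add (h4.mul_const _))
  simp only [hzero] at hlim
  exact (tendsto_nhds_unique hlim tendsto_const_nhds)

theorem dotProduct_insertCoord (w : Fin p → ℝ) (i : Fin p) (v : {j : Fin p // j ≠ i} → ℝ) (t : ℝ) :
    w ⬝ᵥ insertCoord i t v = w i * t + ∑ j : {j : Fin p // j ≠ i}, w j * v j := by
  rw [dotProduct, Fintype.sum_eq_add_sum_subtype_ne _ i, insertCoord_self]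
  congr 1
  refine Finset.sum_congr rfl fun j _ => ?_
  simp [insertCoord, j.2]

/-- Directional derivatives of the prior density do not vanish almost everywhere. -/
theorem IsWellBehavedPrior.not_ae_eq_zero (hQ : IsWellBehavedPrior Θ Q q)
    (hΘ : IsOpen Θ) (hq : ContinuousOn q Θ) (hb : VanishesAtBoundary Θ q) {w : Fin p → ℝ}
    (hw : w ≠ 0) :
    ¬ ∀ᵐ θ ∂volume.restrict (posSet Θ q), ∑ i, w i * pderiv i q θ = 0 := by
  intro h0
  have hD := isOpen_posSet hΘ hq
  have hqi := hQ.integrableOn_posSet hΘ hq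
  -- A bounded smooth test function whose derivative along `w`, namely `(w ⬝ᵥ w) / (1 + (w ⬝ᵥ θ) ^
  -- 2)`, is positive everywhere.
  let φ : (Fin p → ℝ) → ℝ := fun θ => Real.arctan (w ⬝ᵥ θ)
  let φ' : Fin p → (Fin p → ℝ) → ℝ := fun i θ => w i / (1 + (w ⬝ᵥ θ) ^ 2)
  have hdot : Continuous fun θ : Fin p → ℝ => w ⬝ᵥ θ := by
    unfold dotProduct
    fun_prop
  have hφc : Continuous φ := Real.continuous_arctan.comp hdot
  have hφ'c : ∀ i, Continuous (φ' i) := fun i =>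
    continuous_const.div (continuous_const.add (hdot.pow 2)) fun θ => by positivity
  have hφ'i : ∀ i, IntegrableOn (fun θ => φ' i θ * q θ) (posSet Θ q) := fun i =>
    hqi.bdd_mul (c := |w i|) (hφ'c i).aestronglyMeasurable (Eventually.of_forall fun θ => by
      rw [Real.norm_eq_abs, abs_div, abs_of_pos (show 0 < 1 + (w ⬝ᵥ θ) ^ 2 by positivity)]
      exact div_le_self (abs_nonneg _) (by nlinarith [sq_nonneg (w ⬝ᵥ θ)]))
  have hφdi : ∀ i, IntegrableOn (fun θ => φ θ * pderiv i q θ) (posSet Θ q) := fun i =>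
    (hQ.integrableOn_pderiv hΘ hq i).bdd_mul (c := Real.pi / 2) hφc.aestronglyMeasurable
      (Eventually.of_forall fun θ => abs_arctan_le _)
  have hzero : ∀ i, ∫ θ in posSet Θ q, (φ' i θ * q θ + φ θ * pderiv i q θ) = 0 := by
    intro i
    have hder : ∀ (v : {j : Fin p // j ≠ i} → ℝ) (t : ℝ),
        HasDerivAt (fun t => φ (insertCoord i t v)) (φ' i (insertCoord i t v)) t := by
      intro v t
      simp only [φ, φ', dotProduct_insertCoord]
      have h := (((hasDerivAt_id t).const_mul (w i)).add_const
        (∑ j : {j : Fin p // j ≠ i}, w j * v j)).arctan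
      simp only [id, mul_one] at h
      convert h using 1
      ring
    refine hQ.setIntegral_mul_add_mul_pderiv hΘ hq hb i (C := Real.pi / 2)
      (Eventually.of_forall fun v => ?_) (fun θ _ => abs_arctan_le _)
      hφc.aestronglyMeasurable (Eventually.of_forall fun v => Eventually.of_forall fun t _ =>
        (hder v t).deriv) (hφ'i i)
    refine fun a b _ _ => ContDiffOn.absolutelyContinuousOnInterval (ContDiff.contDiffOn ?_)
    simp only [φ, dotProduct_insertCoord]
    exact ((contDiff_const.mul contDiff_id).add contDiff_const).arctan
  have hadd : ∀ i, IntegrableOn (fun θ => w i * (φ' i θ * q θ + φ θ * pderiv i q θ))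
      (posSet Θ q) := fun i => ((hφ'i i).add (hφdi i)).const_mul (w i)
  have hsum : ∫ θ in posSet Θ q, ∑ i, w i * (φ' i θ * q θ + φ θ * pderiv i q θ) = 0 := by
    rw [integral_finsetSum _ fun i _ => hadd i]
    refine Finset.sum_eq_zero fun i _ => ?_
    rw [integral_const_mul, hzero, mul_zero]
  have hae : ∀ᵐ θ ∂volume.restrict (posSet Θ q),
      ∑ i, w i * (φ' i θ * q θ + φ θ * pderiv i q θ) = (w ⬝ᵥ w) / (1 + (w ⬝ᵥ θ) ^ 2) * q θ := by
    filter_upwards [h0] with θ hθ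
    have h1 : ∑ i, w i * (φ' i θ * q θ + φ θ * pderiv i q θ) =
        (∑ i, w i * w i) / (1 + (w ⬝ᵥ θ) ^ 2) * q θ + φ θ * ∑ i, w i * pderiv i q θ := by
      rw [Finset.sum_div, Finset.sum_mul, Finset.mul_sum, ← Finset.sum_add_distrib]
      refine Finset.sum_congr rfl fun i _ => ?_
      simp only [φ']
      ring
    rw [h1, hθ, mul_zero, add_zero]
    rfl
  rw [integral_congr_ae hae] at hsum
  have hint : IntegrableOn (fun θ => (w ⬝ᵥ w) / (1 + (w ⬝ᵥ θ) ^ 2) * q θ) (posSet Θ q) :=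
    (integrable_finsetSum _ fun i _ => hadd i).congr hae
  have hww : 0 < w ⬝ᵥ w :=
    (Finset.sum_nonneg fun i _ => mul_self_nonneg (w i)).lt_of_ne'
      fun h => hw (dotProduct_self_eq_zero.1 h)
  have hnn : 0 ≤ᵐ[volume.restrict (posSet Θ q)]
      fun θ => (w ⬝ᵥ w) / (1 + (w ⬝ᵥ θ) ^ 2) * q θ := by
    filter_upwards [ae_posSet hΘ hq] with θ hθ
    have := hθ.2
    positivity
  have hz := (integral_eq_zero_iff_of_nonneg_ae hnn hint).1 hsum
  have hq1 := hQ.setIntegral_posSet hΘ hq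
  -- A function that is positive on `posSet Θ q` vanishes almost everywhere there, so that set is
  -- null, against total mass one.
  rw [integral_eq_zero_of_ae] at hq1
  · exact zero_ne_one hq1
  filter_upwards [hz, ae_posSet hΘ hq] with θ h1 h2
  have h3 : 0 < (w ⬝ᵥ w) / (1 + (w ⬝ᵥ θ) ^ 2) * q θ := by
    have := h2.2
    positivity
  exact absurd h1 h3.ne'

end Prior

/-! ### Statistics: truncation and integration by parts -/

/-- The truncation of a function to the values in `[-n, n]`. -/
noncomputable def truncate {X : Type*} (T : X → ℝ) (n : ℕ) (x : X) : ℝ := max (-n) (min n (T x))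

theorem abs_truncate_le {X : Type*} (T : X → ℝ) (n : ℕ) (x : X) : |truncate T n x| ≤ n :=
  abs_le.2 ⟨le_max_left _ _, max_le (by linarith [(Nat.cast_nonneg n : (0 : ℝ) ≤ n)])
    (min_le_left _ _)⟩

theorem abs_truncate_le_abs {X : Type*} (T : X → ℝ) (n : ℕ) (x : X) : |truncate T n x| ≤ |T x| := by
  have h0 : (0 : ℝ) ≤ n := Nat.cast_nonneg n
  refine abs_le.2 ⟨?_, max_le (by linarith [abs_nonneg (T x)])
    ((min_le_right _ _).trans (le_abs_self _))⟩
  refine le_max_of_le_right (le_min (by linarith [abs_nonneg (T x)]) (neg_abs_le _))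

theorem tendsto_truncate {X : Type*} (T : X → ℝ) (x : X) :
    Tendsto (fun n => truncate T n x) atTop (𝓝 (T x)) := by
  refine tendsto_const_nhds.congr' ?_
  filter_upwards [eventually_ge_atTop ⌈|T x|⌉₊] with n hn
  have h : |T x| ≤ n := Nat.ceil_le.1 hn
  rw [truncate, min_eq_right ((le_abs_self _).trans h),
    max_eq_right (by linarith [neg_abs_le (T x)])]

section Statistic

variable {p : ℕ} {X : Type*} [MeasurableSpace X] {μ : Measure X}
  {Θ : Set (Fin p → ℝ)} {f : (Fin p → ℝ) → X → ℝ}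
  {Q : Measure (Fin p → ℝ)} {q : (Fin p → ℝ) → ℝ} {ξ' : (Fin p → ℝ) → Fin p → X → ℝ}
  {T : X → ℝ} {θ : Fin p → ℝ} {i : Fin p}

theorem IsModel.integral_sq_mul_sqrt (hf : IsModel μ Θ f) :
    ∫ x, (T x * √(f θ x)) ^ 2 ∂μ = ∫ x, T x ^ 2 * f θ x ∂μ := by
  simp only [mul_pow, Real.sq_sqrt (hf.nonneg θ _)]

theorem IsModel.integral_mul_eq (hf : IsModel μ Θ f) :
    ∫ x, T x * √(f θ x) * √(f θ x) ∂μ = ∫ x, T x * f θ x ∂μ := by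
  simp only [mul_assoc, Real.mul_self_sqrt (hf.nonneg θ _)]

theorem IsModel.abs_two_mul_integral_le (hf : IsModel μ Θ f) {g : X → ℝ} (hT : Measurable T)
    (hi : Integrable (fun x => T x ^ 2 * f θ x) μ) (hg : MemLp g 2 μ) :
    |2 * ∫ x, T x * (√(f θ x) * g x) ∂μ| ≤
      (∫ x, T x ^ 2 * f θ x ∂μ) + ∫ x, g x * g x ∂μ := by
  have h := two_mul_abs_integral_mul_le (hf.memLp_mul_sqrt hT hi) hg
  rw [hf.integral_sq_mul_sqrt] at h
  simp only [mul_assoc, sq (g _)] at h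
  rwa [abs_mul, abs_two]

/-- Cauchy-Schwarz for `T √f` and the unit vector `√f`. -/
theorem IsModel.sq_integral_le (hf : IsModel μ Θ f) (hθ : θ ∈ Θ) (hT : Measurable T)
    (hi : Integrable (fun x => T x ^ 2 * f θ x) μ) :
    (∫ x, T x * f θ x ∂μ) ^ 2 ≤ ∫ x, T x ^ 2 * f θ x ∂μ := by
  have h1 := hf.memLp_mul_sqrt hT hi
  have h2 := hf.memLp_sqrt hθ
  have h := real_inner_mul_inner_self_le (toL2 μ fun x => T x * √(f θ x))
    (toL2 μ fun x => √(f θ x))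
  rw [inner_toL2 h1 h2, inner_toL2 h1 h1, inner_toL2 h2 h2, hf.integral_mul_eq] at h
  simp only [Real.mul_self_sqrt (hf.nonneg θ _), hf.integral hθ, ← sq,
    hf.integral_sq_mul_sqrt, mul_one] at h
  exact h

theorem measurable_truncate (hT : Measurable T) (n : ℕ) : Measurable (truncate T n) :=
  measurable_const.max (measurable_const.min hT)

theorem tendsto_integral_truncate_mul {u : X → ℝ} (hT : Measurable T)
    (hu : AEStronglyMeasurable u μ) (hi : Integrable (fun x => T x * u x) μ) :
    Tendsto (fun n => ∫ x, truncate T n x * u x ∂μ) atTop (𝓝 (∫ x, T x * u x ∂μ)) := by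
  refine tendsto_integral_of_dominated_convergence _
    (fun n => (measurable_truncate hT n).aestronglyMeasurable.mul hu) hi.norm
    (fun n => Eventually.of_forall fun x => ?_)
    (Eventually.of_forall fun x => (tendsto_truncate T x).mul_const _)
  rw [norm_mul, norm_mul]
  exact mul_le_mul_of_nonneg_right (abs_truncate_le_abs T n x) (norm_nonneg _)

theorem IsModel.integrable_mul (hf : IsModel μ Θ f) (hT : Measurable T) (hθ : θ ∈ Θ)
    (hi : Integrable (fun x => T x ^ 2 * f θ x) μ) : Integrable (fun x => T x * f θ x) μ := by
  refine ((hf.memLp_mul_sqrt hT hi).integrable_mul (hf.memLp_sqrt hθ)).congr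
    (Eventually.of_forall fun x => ?_)
  simp only [Pi.mul_apply, mul_assoc, Real.mul_self_sqrt (hf.nonneg θ x)]

theorem IsModel.integrable_mul_sqrt_mul (hf : IsModel μ Θ f) {g : X → ℝ} (hT : Measurable T)
    (hi : Integrable (fun x => T x ^ 2 * f θ x) μ) (hg : MemLp g 2 μ) :
    Integrable (fun x => T x * (√(f θ x) * g x)) μ := by
  refine ((hf.memLp_mul_sqrt hT hi).integrable_mul hg).congr (Eventually.of_forall fun x => ?_)
  simp only [Pi.mul_apply, mul_assoc]

theorem IsModel.integrable_truncate (hf : IsModel μ Θ f) (hT : Measurable T)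
    (hi : Integrable (fun x => T x ^ 2 * f θ x) μ) (n : ℕ) :
    Integrable (fun x => truncate T n x ^ 2 * f θ x) μ ∧
      ∫ x, truncate T n x ^ 2 * f θ x ∂μ ≤ ∫ x, T x ^ 2 * f θ x ∂μ := by
  have hle : ∀ x, truncate T n x ^ 2 * f θ x ≤ T x ^ 2 * f θ x := fun x =>
    mul_le_mul_of_nonneg_right (sq_le_sq.2 (abs_truncate_le_abs T n x)) (hf.nonneg θ x)
  have h1 : Integrable (fun x => truncate T n x ^ 2 * f θ x) μ := by
    refine hi.mono' (((measurable_truncate hT n).pow_const 2).mul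
      (hf.measurable θ)).aestronglyMeasurable (Eventually.of_forall fun x => ?_)
    rw [Real.norm_of_nonneg (mul_nonneg (sq_nonneg _) (hf.nonneg θ x))]
    exact hle x
  exact ⟨h1, integral_mono h1 hi hle⟩

variable [SigmaFinite μ]

/-- Integration by parts of the expectation of a bounded statistic against the prior density. -/
theorem IsWellBehavedPrior.setIntegral_bounded_statistic (hQ : IsWellBehavedPrior Θ Q q)
    (hΘ : IsOpen Θ) (hq : ContinuousOn q Θ) (hb : VanishesAtBoundary Θ q) (hf : IsModel μ Θ f)
    (hξ : ∀ θ ∈ posSet Θ q, ∀ i, IsL2PartialDeriv μ f θ i (ξ' θ i))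
    (hI : IntegrableOn (fun θ => q θ * ∫ x, ξ' θ i x * ξ' θ i x ∂μ) (posSet Θ q))
    {C : ℝ} (hT : Measurable T) (hC : ∀ x, |T x| ≤ C) :
    ∫ θ in posSet Θ q, ((2 * ∫ x, T x * (√(f θ x) * ξ' θ i x) ∂μ) * q θ +
      (∫ x, T x * f θ x ∂μ) * pderiv i q θ) = 0 := by
  have hD := isOpen_posSet hΘ hq
  have hTi : ∀ θ ∈ Θ, Integrable (fun x => T x * f θ x) μ := fun θ hθ =>
    (hf.integrable hθ).bdd_mul hT.aestronglyMeasurable (Eventually.of_forall hC)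
  have hC2 : ∀ x, |T x ^ 2| ≤ C ^ 2 := fun x => by
    rw [abs_pow]
    exact pow_le_pow_left₀ (abs_nonneg _) (hC x) 2
  have hT2i : ∀ θ ∈ Θ, Integrable (fun x => T x ^ 2 * f θ x) μ := fun θ hθ =>
    (hf.integrable hθ).bdd_mul (hT.pow_const 2).aestronglyMeasurable (Eventually.of_forall hC2)
  have hW : ∀ θ ∈ Θ, ∫ x, T x ^ 2 * f θ x ∂μ ≤ C ^ 2 := by
    intro θ hθ
    have h := integral_mono (hT2i θ hθ) ((hf.integrable hθ).const_mul (C ^ 2)) fun x =>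
      mul_le_mul_of_nonneg_right ((le_abs_self _).trans (hC2 x)) (hf.nonneg θ x)
    rwa [integral_const_mul, hf.integral hθ, mul_one] at h
  have hder : ∀ (v : {j : Fin p // j ≠ i} → ℝ) (t : ℝ), insertCoord i t v ∈ posSet Θ q →
      HasDerivAt (fun t => ∫ x, T x * f (insertCoord i t v) x ∂μ)
        (2 * ∫ x, T x * (√(f (insertCoord i t v) x) * ξ' (insertCoord i t v) i x) ∂μ) t := by
    intro v t ht
    have h := hf.hasDerivAt_integral hΘ ht.1 (hξ _ ht i) hT hC
    simpa only [update_insertCoord, insertCoord_self] using h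
  have hdi : IntegrableOn (fun θ => (2 * ∫ x, T x * (√(f θ x) * ξ' θ i x) ∂μ) * q θ)
      (posSet Θ q) := by
    refine (((hQ.integrableOn_posSet hΘ hq).mul_const (C ^ 2)).add hI).mono'
      ((hf.aestronglyMeasurable_integral_mul_of_bounded hΘ posSet_subset hD.measurableSet hξ hT
        hC).mul (aemeasurable_posSet hΘ hq).aestronglyMeasurable) ?_
    filter_upwards [ae_restrict_mem hD.measurableSet] with θ hθ
    rw [norm_mul, Real.norm_of_nonneg hθ.2.le, mul_comm, Pi.add_apply, ← mul_add]
    refine mul_le_mul_of_nonneg_left ?_ hθ.2.le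
    exact (hf.abs_two_mul_integral_le hT (hT2i θ hθ.1) (hξ θ hθ i).1).trans
      (add_le_add_left (hW θ hθ.1) _)
  refine hQ.setIntegral_mul_add_mul_pderiv hΘ hq hb i (C := C) ?_ ?_
    (hf.stronglyMeasurable_integral hT).aestronglyMeasurable
    (Eventually.of_forall fun v => Eventually.of_forall fun t ht => (hder v t ht).deriv) hdi
  -- Along every line the expectation is differentiable throughout the slice; along almost every
  -- line, by Fubini, its derivative times `q` is integrable. This makes it absolutely continuous.
  · filter_upwards [integrable_insertCoord i hD.measurableSet hdi] with v hv
    refine absContOn_of_hasDerivAt (q := fun t => q (insertCoord i t v)) (fun t ht => hder v t ht)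
      ((hq.mono posSet_subset).comp (continuous_insertCoord i v).continuousOn fun t ht => ht)
      (fun t ht => ht.2) hv
  · intro θ hθ
    refine (abs_integral_le_integral_abs).trans ?_
    have h := integral_mono (hTi θ hθ.1).abs ((hf.integrable hθ.1).const_mul C) fun x => by
      rw [abs_mul, abs_of_nonneg (hf.nonneg θ x)]
      exact mul_le_mul_of_nonneg_right (hC x) (hf.nonneg θ x)
    rwa [integral_const_mul, hf.integral hθ.1, mul_one] at h

theorem IsModel.aestronglyMeasurable_integral_mul (hf : IsModel μ Θ f)
    (hΘ : IsOpen Θ) (hq : ContinuousOn q Θ)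
    (hξ : ∀ θ ∈ posSet Θ q, ∀ i, IsL2PartialDeriv μ f θ i (ξ' θ i)) (hT : Measurable T)
    (hTi : ∀ᵐ θ ∂volume.restrict (posSet Θ q), Integrable (fun x => T x ^ 2 * f θ x) μ) :
    AEStronglyMeasurable (fun θ => 2 * ∫ x, T x * (√(f θ x) * ξ' θ i x) ∂μ)
      (volume.restrict (posSet Θ q)) := by
  have hD := (isOpen_posSet hΘ hq).measurableSet
  refine aestronglyMeasurable_of_tendsto_ae atTop (fun n =>
    hf.aestronglyMeasurable_integral_mul_of_bounded (i := i) hΘ posSet_subset hD hξ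
      (measurable_truncate hT n) (abs_truncate_le T n)) ?_
  filter_upwards [hTi, ae_restrict_mem hD] with θ h1 h2
  exact (tendsto_integral_truncate_mul hT
    ((hf.measurable θ).sqrt.aestronglyMeasurable.mul (hξ θ h2 i).1.1)
    (hf.integrable_mul_sqrt_mul hT h1 (hξ θ h2 i).1)).const_mul 2

theorem IsModel.integrableOn_score (hf : IsModel μ Θ f) (hΘ : IsOpen Θ) (hq : ContinuousOn q Θ)
    (hξ : ∀ θ ∈ posSet Θ q, ∀ i, IsL2PartialDeriv μ f θ i (ξ' θ i))
    (hI : IntegrableOn (fun θ => q θ * ∫ x, ξ' θ i x * ξ' θ i x ∂μ) (posSet Θ q))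
    (hT : Measurable T)
    (hTi : ∀ᵐ θ ∂volume.restrict (posSet Θ q), Integrable (fun x => T x ^ 2 * f θ x) μ)
    (hTq : IntegrableOn (fun θ => q θ * ∫ x, T x ^ 2 * f θ x ∂μ) (posSet Θ q)) :
    IntegrableOn (fun θ => (2 * ∫ x, T x * (√(f θ x) * ξ' θ i x) ∂μ) * q θ) (posSet Θ q) := by
  refine (hTq.add hI).mono' ((hf.aestronglyMeasurable_integral_mul hΘ hq hξ hT hTi).mul
    (aemeasurable_posSet hΘ hq).aestronglyMeasurable) ?_
  filter_upwards [ae_restrict_mem (isOpen_posSet hΘ hq).measurableSet, hTi] with θ hθ hi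
  rw [norm_mul, Real.norm_of_nonneg hθ.2.le, mul_comm, Pi.add_apply, ← mul_add]
  exact mul_le_mul_of_nonneg_left (hf.abs_two_mul_integral_le hT hi (hξ θ hθ i).1) hθ.2.le

theorem IsModel.integrableOn_mul_sq_integral (hf : IsModel μ Θ f) (hΘ : IsOpen Θ)
    (hq : ContinuousOn q Θ) (hT : Measurable T)
    (hTi : ∀ᵐ θ ∂volume.restrict (posSet Θ q), Integrable (fun x => T x ^ 2 * f θ x) μ)
    (hTq : IntegrableOn (fun θ => q θ * ∫ x, T x ^ 2 * f θ x ∂μ) (posSet Θ q)) :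
    IntegrableOn (fun θ => q θ * (∫ x, T x * f θ x ∂μ) ^ 2) (posSet Θ q) := by
  have hm := (hf.stronglyMeasurable_integral hT).measurable
  refine hTq.mono' ((aemeasurable_posSet hΘ hq).mul
    (hm.pow_const 2).aemeasurable).aestronglyMeasurable ?_
  filter_upwards [ae_posSet hΘ hq, hTi] with θ hθ hi
  rw [Real.norm_of_nonneg (mul_nonneg hθ.2.le (sq_nonneg _))]
  exact mul_le_mul_of_nonneg_left (hf.sq_integral_le hθ.1 hT hi) hθ.2.le

/-- Integration by parts of the expectation of a statistic against the prior density. -/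
theorem IsWellBehavedPrior.setIntegral_statistic (hQ : IsWellBehavedPrior Θ Q q)
    (hΘ : IsOpen Θ) (hq : ContinuousOn q Θ) (hb : VanishesAtBoundary Θ q) (hf : IsModel μ Θ f)
    (hξ : ∀ θ ∈ posSet Θ q, ∀ i, IsL2PartialDeriv μ f θ i (ξ' θ i))
    (hI : IntegrableOn (fun θ => q θ * ∫ x, ξ' θ i x * ξ' θ i x ∂μ) (posSet Θ q))
    (hT : Measurable T)
    (hTi : ∀ᵐ θ ∂volume.restrict (posSet Θ q), Integrable (fun x => T x ^ 2 * f θ x) μ)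
    (hTq : IntegrableOn (fun θ => q θ * ∫ x, T x ^ 2 * f θ x ∂μ) (posSet Θ q)) :
    ∫ θ in posSet Θ q, ((2 * ∫ x, T x * (√(f θ x) * ξ' θ i x) ∂μ) * q θ +
      (∫ x, T x * f θ x ∂μ) * pderiv i q θ) = 0 := by
  have hD := (isOpen_posSet hΘ hq).measurableSet
  -- Truncation does not increase second moments, so the bounds by `E_θ[T²]`, `∫ ξ'_i² dμ` and
  -- `(∂ᵢq)²/q` hold uniformly in `n`.
  have hlim := tendsto_integral_of_dominated_convergence (μ := volume.restrict (posSet Θ q))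
    (F := fun n θ => (2 * ∫ x, truncate T n x * (√(f θ x) * ξ' θ i x) ∂μ) * q θ +
      (∫ x, truncate T n x * f θ x ∂μ) * pderiv i q θ)
    (f := fun θ => (2 * ∫ x, T x * (√(f θ x) * ξ' θ i x) ∂μ) * q θ +
      (∫ x, T x * f θ x ∂μ) * pderiv i q θ) _
    (fun n => ((hf.aestronglyMeasurable_integral_mul_of_bounded hΘ posSet_subset hD hξ
        (measurable_truncate hT n) (abs_truncate_le T n)).mul
        (aemeasurable_posSet hΘ hq).aestronglyMeasurable).add
      ((hf.stronglyMeasurable_integral (measurable_truncate hT n)).aestronglyMeasurable.mul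
        (aemeasurable_pderiv_posSet hΘ hq i).aestronglyMeasurable))
    ((hTq.add hI).add ((hQ.integrableOn_sq_div hΘ hq i).add hTq))
    (fun n => by
      filter_upwards [ae_restrict_mem hD, hTi] with θ hθ hi
      obtain ⟨h1, h2⟩ := hf.integrable_truncate hT hi n
      refine (norm_add_le _ _).trans (add_le_add ?_ ?_)
      · rw [norm_mul, Real.norm_of_nonneg hθ.2.le, mul_comm, Pi.add_apply, ← mul_add]
        refine mul_le_mul_of_nonneg_left ?_ hθ.2.le
        exact (hf.abs_two_mul_integral_le (measurable_truncate hT n) h1 (hξ θ hθ i).1).trans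
          (add_le_add_left h2 _)
      · rw [mul_comm]
        refine (abs_mul_le_sq_div_add hθ.2).trans (add_le_add_right ?_ _)
        refine mul_le_mul_of_nonneg_left ?_ hθ.2.le
        exact (hf.sq_integral_le hθ.1 (measurable_truncate hT n) h1).trans h2)
    (by
      filter_upwards [ae_restrict_mem hD, hTi] with θ hθ hi
      refine (((tendsto_integral_truncate_mul hT
        ((hf.measurable θ).sqrt.aestronglyMeasurable.mul (hξ θ hθ i).1.1)
        (hf.integrable_mul_sqrt_mul hT hi (hξ θ hθ i).1)).const_mul 2).mul_const _).add
        ((tendsto_integral_truncate_mul hT (hf.measurable θ).aestronglyMeasurable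
          (hf.integrable_mul hT hθ.1 hi)).mul_const _))
  have hzero : ∀ n : ℕ, ∫ θ in posSet Θ q,
      ((2 * ∫ x, truncate T n x * (√(f θ x) * ξ' θ i x) ∂μ) * q θ +
        (∫ x, truncate T n x * f θ x ∂μ) * pderiv i q θ) = 0 := fun n =>
    hQ.setIntegral_bounded_statistic hΘ hq hb hf hξ hI (measurable_truncate hT n)
      (abs_truncate_le T n)
  simp only [hzero] at hlim
  exact tendsto_nhds_unique hlim tendsto_const_nhds

end Statistic

/-! ### Integrated Gram matrices and definiteness of the prior information -/

/-- The quadratic form at `y` is the `w`-weighted integral of `∫ (∑ y_k G_k)² dμ`. -/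
theorem posSemidef_integral_gram {n α X : Type*} [Fintype n] [MeasurableSpace α]
    [MeasurableSpace X] {ν : Measure α} {μ : Measure X} {w : α → ℝ} {G : α → n → X → ℝ}
    (hw : ∀ᵐ θ ∂ν, 0 ≤ w θ) (hG : ∀ᵐ θ ∂ν, ∀ k, MemLp (G θ k) 2 μ)
    (hi : ∀ k l, Integrable (fun θ => w θ * ∫ x, G θ k x * G θ l x ∂μ) ν) :
    (Matrix.of fun k l => ∫ θ, w θ * ∫ x, G θ k x * G θ l x ∂μ ∂ν).PosSemidef := by
  refine Matrix.PosSemidef.of_dotProduct_mulVec_nonneg ?_ fun y => ?_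
  · ext k l
    simp only [Matrix.conjTranspose_apply, Matrix.of_apply, star_trivial, mul_comm (G _ k _)]
  have hi' : ∀ k l, Integrable (fun θ => y k * ((w θ * ∫ x, G θ k x * G θ l x ∂μ) * y l)) ν :=
    fun k l => ((hi k l).mul_const (y l)).const_mul (y k)
  have h1 : star y ⬝ᵥ ((Matrix.of fun k l => ∫ θ, w θ * ∫ x, G θ k x * G θ l x ∂μ ∂ν).mulVec y) =
      ∫ θ, ∑ k, ∑ l, y k * ((w θ * ∫ x, G θ k x * G θ l x ∂μ) * y l) ∂ν := by
    rw [integral_finsetSum _ fun k _ => integrable_finsetSum _ fun l _ => hi' k l]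
    simp only [dotProduct, Matrix.mulVec, star_trivial, Matrix.of_apply, Finset.mul_sum]
    refine Finset.sum_congr rfl fun k _ => ?_
    rw [integral_finsetSum _ fun l _ => hi' k l]
    refine Finset.sum_congr rfl fun l _ => ?_
    rw [integral_const_mul, integral_mul_const]
  rw [h1]
  refine integral_nonneg_of_ae ?_
  filter_upwards [hw, hG] with θ h2 h3
  have h4 : ∀ k l, Integrable (fun x => (y k * G θ k x) * (y l * G θ l x)) μ := fun k l =>
    ((h3 k).const_mul (y k)).integrable_mul ((h3 l).const_mul (y l))
  have h5 : ∑ k, ∑ l, y k * ((w θ * ∫ x, G θ k x * G θ l x ∂μ) * y l) =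
      w θ * ∫ x, (∑ k, y k * G θ k x) ^ 2 ∂μ := by
    simp only [sq, Finset.sum_mul_sum]
    rw [integral_finsetSum _ fun k _ => integrable_finsetSum _ fun l _ => h4 k l, Finset.mul_sum]
    refine Finset.sum_congr rfl fun k _ => ?_
    rw [integral_finsetSum _ fun l _ => h4 k l, Finset.mul_sum]
    refine Finset.sum_congr rfl fun l _ => ?_
    have : (fun x => y k * G θ k x * (y l * G θ l x)) =
        fun x => (y k * y l) * (G θ k x * G θ l x) := by
      funext x; ring
    rw [this, integral_const_mul]
    ring
  rw [Pi.zero_apply, h5]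
  exact mul_nonneg h2 (integral_nonneg fun x => sq_nonneg _)

section Prior

variable {p : ℕ} {Θ : Set (Fin p → ℝ)} {Q : Measure (Fin p → ℝ)} {q : (Fin p → ℝ) → ℝ}

/-- The quadratic form at `w` is `∫ (∑ wᵢ ∂ᵢq)² / q`. If it vanished, so would the derivative of `q`
along `w` almost everywhere, which `not_ae_eq_zero` excludes. -/
theorem IsWellBehavedPrior.posDef_fisherPrior (hQ : IsWellBehavedPrior Θ Q q)
    (hΘ : IsOpen Θ) (hq : ContinuousOn q Θ) (hb : VanishesAtBoundary Θ q) :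
    (fisherPrior Θ q).PosDef := by
  refine Matrix.PosDef.of_dotProduct_mulVec_pos ?_ fun w hw => ?_
  · ext i k
    simp only [Matrix.conjTranspose_apply, fisherPrior_apply hΘ hq, star_trivial,
      mul_comm (pderiv i q _)]
  have hi : ∀ i k, IntegrableOn
      (fun θ => w i * (pderiv i q θ * pderiv k q θ / q θ * w k)) (posSet Θ q) := fun i k =>
    ((hQ.integrableOn_mul_div hΘ hq i k).mul_const (w k)).const_mul (w i)
  have hsq : ∀ θ, ∑ i, ∑ k, w i * (pderiv i q θ * pderiv k q θ / q θ * w k) =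
      (∑ i, w i * pderiv i q θ) ^ 2 / q θ := by
    intro θ
    rw [sq, Finset.sum_mul_sum, Finset.sum_div]
    refine Finset.sum_congr rfl fun i _ => ?_
    rw [Finset.sum_div]
    refine Finset.sum_congr rfl fun k _ => ?_
    ring
  have h1 : star w ⬝ᵥ ((fisherPrior Θ q).mulVec w) =
      ∫ θ in posSet Θ q, (∑ i, w i * pderiv i q θ) ^ 2 / q θ := by
    simp only [← hsq]
    rw [integral_finsetSum _ fun i _ => integrable_finsetSum _ fun k _ => hi i k]
    simp only [dotProduct, Matrix.mulVec, star_trivial, Finset.mul_sum]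
    refine Finset.sum_congr rfl fun i _ => ?_
    rw [integral_finsetSum _ fun k _ => hi i k]
    refine Finset.sum_congr rfl fun k _ => ?_
    rw [integral_const_mul, integral_mul_const, fisherPrior_apply hΘ hq]
  have hnn : 0 ≤ᵐ[volume.restrict (posSet Θ q)]
      fun θ => (∑ i, w i * pderiv i q θ) ^ 2 / q θ := by
    filter_upwards [ae_posSet hΘ hq] with θ hθ
    exact div_nonneg (sq_nonneg _) hθ.2.le
  have hint : IntegrableOn (fun θ => (∑ i, w i * pderiv i q θ) ^ 2 / q θ) (posSet Θ q) := by
    simp only [← hsq]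
    exact integrable_finsetSum _ fun i _ => integrable_finsetSum _ fun k _ => hi i k
  rw [h1]
  refine (integral_nonneg_of_ae hnn).lt_of_ne' fun h0 => ?_
  refine hQ.not_ae_eq_zero hΘ hq hb hw ?_
  filter_upwards [(integral_eq_zero_iff_of_nonneg_ae hnn hint).1 h0, ae_posSet hΘ hq] with θ h2 h3
  exact pow_eq_zero_iff two_ne_zero |>.1 ((div_eq_zero_iff.1 h2).resolve_right h3.2.ne')

end Prior

/-! ### Inner products of scores and errors, and their integrability -/

section Model

variable {p : ℕ} {X : Type*} [MeasurableSpace X] {μ : Measure X}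
  {Θ : Set (Fin p → ℝ)} {f : (Fin p → ℝ) → X → ℝ}
  {Q : Measure (Fin p → ℝ)} {q : (Fin p → ℝ) → ℝ} {ξ' : (Fin p → ℝ) → Fin p → X → ℝ}
  {T : X → ℝ} {θ : Fin p → ℝ} {i : Fin p}

/-- Centring removes the mixed terms. With `a = ∂ᵢq/q` and `b = ∂ₖq/q` this is the additivity of
prior and model information. -/
theorem IsModel.integral_score_mul_score (hf : IsModel μ Θ f) (hθ : θ ∈ Θ) {g h : X → ℝ}
    (hg : MemLp g 2 μ) (hh : MemLp h 2 μ) (hg0 : ∫ x, √(f θ x) * g x ∂μ = 0)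
    (hh0 : ∫ x, √(f θ x) * h x ∂μ = 0) (a b : ℝ) :
    ∫ x, (a * √(f θ x) + 2 * g x) * (b * √(f θ x) + 2 * h x) ∂μ =
      a * b + 4 * ∫ x, g x * h x ∂μ := by
  have hξ := hf.memLp_sqrt hθ
  have hgi : Integrable (fun x => √(f θ x) * g x) μ := hξ.integrable_mul hg
  have hhi : Integrable (fun x => √(f θ x) * h x) μ := hξ.integrable_mul hh
  have hgh : Integrable (fun x => g x * h x) μ := hg.integrable_mul hh
  have he : ∀ x, (a * √(f θ x) + 2 * g x) * (b * √(f θ x) + 2 * h x) =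
      ((a * b) * f θ x + (2 * a) * (√(f θ x) * h x)) +
        ((2 * b) * (√(f θ x) * g x) + 4 * (g x * h x)) := by
    intro x
    nth_rewrite 3 [← Real.mul_self_sqrt (hf.nonneg θ x)]
    ring
  simp only [he]
  have h1 : Integrable (fun x => (a * b) * f θ x + (2 * a) * (√(f θ x) * h x)) μ :=
    ((hf.integrable hθ).const_mul _).add (hhi.const_mul _)
  have h2 : Integrable (fun x => (2 * b) * (√(f θ x) * g x) + 4 * (g x * h x)) μ :=
    (hgi.const_mul _).add (hgh.const_mul _)
  rw [integral_add h1 h2, integral_add ((hf.integrable hθ).const_mul _) (hhi.const_mul _),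
    integral_add (hgi.const_mul _) (hgh.const_mul _)]
  simp only [integral_const_mul, hg0, hh0, hf.integral hθ]
  ring

/-- Used with `a = ∂ᵢq/q` and `c = ψ_j(θ)`. Centring removes the product of `c` with the model
score, so `ψ` meets only the prior score. -/
theorem IsModel.integral_score_mul_error (hf : IsModel μ Θ f) (hθ : θ ∈ Θ) {g : X → ℝ}
    (hT : Measurable T) (hi : Integrable (fun x => T x ^ 2 * f θ x) μ)
    (hg : MemLp g 2 μ) (hg0 : ∫ x, √(f θ x) * g x ∂μ = 0) (a c : ℝ) :
    ∫ x, (a * √(f θ x) + 2 * g x) * ((T x - c) * √(f θ x)) ∂μ =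
      a * ((∫ x, T x * f θ x ∂μ) - c) + 2 * ∫ x, T x * (√(f θ x) * g x) ∂μ := by
  have hgi : Integrable (fun x => √(f θ x) * g x) μ := (hf.memLp_sqrt hθ).integrable_mul hg
  have hTi := hf.integrable_mul hT hθ hi
  have hTg := hf.integrable_mul_sqrt_mul hT hi hg
  have he : ∀ x, (a * √(f θ x) + 2 * g x) * ((T x - c) * √(f θ x)) =
      (a * (T x * f θ x) + (-a * c) * f θ x) +
        (2 * (T x * (√(f θ x) * g x)) + (-2 * c) * (√(f θ x) * g x)) := by
    intro x
    calc _ = a * (T x - c) * (√(f θ x) * √(f θ x)) + (2 * (T x * (√(f θ x) * g x)) +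
          (-2 * c) * (√(f θ x) * g x)) := by ring
      _ = _ := by rw [Real.mul_self_sqrt (hf.nonneg θ x)]; ring
  simp only [he]
  have h1 : Integrable (fun x => a * (T x * f θ x) + (-a * c) * f θ x) μ :=
    (hTi.const_mul _).add ((hf.integrable hθ).const_mul _)
  have h2 : Integrable (fun x => 2 * (T x * (√(f θ x) * g x)) + (-2 * c) * (√(f θ x) * g x)) μ :=
    (hTg.const_mul _).add (hgi.const_mul _)
  rw [integral_add h1 h2, integral_add (hTi.const_mul _) ((hf.integrable hθ).const_mul _),
    integral_add (hTg.const_mul _) (hgi.const_mul _)]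
  simp only [integral_const_mul, hg0, hf.integral hθ]
  ring

theorem IsModel.memLp_error (hf : IsModel μ Θ f) (hθ : θ ∈ Θ) (hT : Measurable T)
    (hi : Integrable (fun x => T x ^ 2 * f θ x) μ) (c : ℝ) :
    MemLp (fun x => (T x - c) * √(f θ x)) 2 μ := by
  have h := (hf.memLp_mul_sqrt hT hi).sub ((hf.memLp_sqrt hθ).const_mul c)
  refine h.ae_eq (Eventually.of_forall fun x => ?_)
  simp only [Pi.sub_apply]
  ring

theorem IsModel.integral_sq_error_le (hf : IsModel μ Θ f) (hθ : θ ∈ Θ) (hT : Measurable T)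
    (hi : Integrable (fun x => T x ^ 2 * f θ x) μ) (c : ℝ) :
    ∫ x, ((T x - c) * √(f θ x)) ^ 2 ∂μ ≤ 2 * (∫ x, T x ^ 2 * f θ x ∂μ) + 2 * c ^ 2 := by
  have h1 := (hi.const_mul 2).add ((hf.integrable hθ).const_mul (2 * c ^ 2))
  have h := integral_mono (hf.memLp_error hθ hT hi c).integrable_sq h1 fun x => by
    simp only [mul_pow, Real.sq_sqrt (hf.nonneg θ x), Pi.add_apply]
    nlinarith [mul_nonneg (sq_nonneg (T x + c)) (hf.nonneg θ x)]
  rwa [integral_add' (hi.const_mul 2) ((hf.integrable hθ).const_mul (2 * c ^ 2)),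
    integral_const_mul, integral_const_mul, hf.integral hθ, mul_one] at h

variable [SigmaFinite μ]

/-- By Cauchy-Schwarz each entry is controlled by two diagonal ones, and these by the trace, as all
diagonal entries are nonnegative. -/
theorem IsModel.integrableOn_fisher (hf : IsModel μ Θ f) (hΘ : IsOpen Θ) (hq : ContinuousOn q Θ)
    (hξ : ∀ θ ∈ posSet Θ q, ∀ i, IsL2PartialDeriv μ f θ i (ξ' θ i))
    (hI : IntegrableOn (fun θ => q θ * (fisherModel μ (ξ' θ)).trace) (posSet Θ q)) (i k : Fin p) :
    IntegrableOn (fun θ => q θ * ∫ x, ξ' θ i x * ξ' θ k x ∂μ) (posSet Θ q) := by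
  have hD := (isOpen_posSet hΘ hq).measurableSet
  refine hI.mono' ((aemeasurable_posSet hΘ hq).aestronglyMeasurable.mul
    (hf.aestronglyMeasurable_fisher hΘ posSet_subset hD hξ)) ?_
  filter_upwards [ae_restrict_mem hD] with θ hθ
  rw [norm_mul, Real.norm_of_nonneg hθ.2.le]
  refine mul_le_mul_of_nonneg_left ?_ hθ.2.le
  have h := two_mul_abs_integral_mul_le (hξ θ hθ i).1 (hξ θ hθ k).1
  have hle : ∀ j, 4 * ∫ x, ξ' θ j x ^ 2 ∂μ ≤ (fisherModel μ (ξ' θ)).trace := by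
    intro j
    simp only [Matrix.trace, Matrix.diag, fisherModel, Matrix.of_apply, ← sq]
    exact Finset.single_le_sum (f := fun j => 4 * ∫ x, ξ' θ j x ^ 2 ∂μ)
      (fun _ _ => mul_nonneg (by norm_num) (integral_nonneg fun _ => sq_nonneg _))
      (Finset.mem_univ j)
  rw [Real.norm_eq_abs]
  have h0 := abs_nonneg (∫ x, ξ' θ i x * ξ' θ k x ∂μ)
  linarith [hle i, hle k]

theorem IsModel.integrableOn_error (hf : IsModel μ Θ f) (hΘ : IsOpen Θ) (hq : ContinuousOn q Θ)
    {T U : X → ℝ} {φ χ : (Fin p → ℝ) → ℝ} (hT : Measurable T) (hU : Measurable U)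
    (hTi : ∀ᵐ θ ∂volume.restrict (posSet Θ q), Integrable (fun x => T x ^ 2 * f θ x) μ)
    (hUi : ∀ᵐ θ ∂volume.restrict (posSet Θ q), Integrable (fun x => U x ^ 2 * f θ x) μ)
    (hTq : IntegrableOn (fun θ => q θ * ∫ x, T x ^ 2 * f θ x ∂μ) (posSet Θ q))
    (hUq : IntegrableOn (fun θ => q θ * ∫ x, U x ^ 2 * f θ x ∂μ) (posSet Θ q))
    (hφ : AEStronglyMeasurable φ (volume.restrict (posSet Θ q)))
    (hχ : AEStronglyMeasurable χ (volume.restrict (posSet Θ q)))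
    (hφq : IntegrableOn (fun θ => q θ * φ θ ^ 2) (posSet Θ q))
    (hχq : IntegrableOn (fun θ => q θ * χ θ ^ 2) (posSet Θ q)) :
    IntegrableOn (fun θ => q θ *
      ∫ x, ((T x - φ θ) * √(f θ x)) * ((U x - χ θ) * √(f θ x)) ∂μ) (posSet Θ q) := by
  have hm : ∀ {T : X → ℝ} {φ : (Fin p → ℝ) → ℝ}, Measurable T →
      AEStronglyMeasurable φ (volume.restrict (posSet Θ q)) →
      AEStronglyMeasurable (fun z : (Fin p → ℝ) × X => (T z.2 - φ z.1) * √(f z.1 z.2))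
        ((volume.restrict (posSet Θ q)).prod μ) := fun hT hφ =>
    ((hT.comp measurable_snd).aestronglyMeasurable.sub hφ.comp_fst).mul
      hf.meas.sqrt.aestronglyMeasurable
  have hmeas := ((hm hT hφ).mul (hm hU hχ)).integral_prod_right'
  refine ((hTq.add hφq).add (hUq.add hχq)).mono'
    ((aemeasurable_posSet hΘ hq).aestronglyMeasurable.mul hmeas) ?_
  filter_upwards [ae_posSet hΘ hq, hTi, hUi] with θ hθ h1 h2
  rw [norm_mul, Real.norm_of_nonneg hθ.2.le]
  simp only [Pi.add_apply, ← mul_add]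
  refine mul_le_mul_of_nonneg_left ?_ hθ.2.le
  have h3 := two_mul_abs_integral_mul_le (hf.memLp_error hθ.1 hT h1 (φ θ))
    (hf.memLp_error hθ.1 hU h2 (χ θ))
  rw [Real.norm_eq_abs]
  linarith [hf.integral_sq_error_le hθ.1 hT h1 (φ θ), hf.integral_sq_error_le hθ.1 hU h2 (χ θ)]

/-- A finite extended integral forces the inner one to be finite almost everywhere, since `q > 0`
there. Bochner integrals could not express the hypothesis: they are zero for nonintegrable
functions. -/
theorem IsModel.integrable_of_lintegral (hf : IsModel μ Θ f) (hΘ : IsOpen Θ)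
    (hq : ContinuousOn q Θ) (hT : Measurable T)
    (h : ∫⁻ θ in posSet Θ q, ENNReal.ofReal (q θ) * ∫⁻ x, ENNReal.ofReal (T x ^ 2 * f θ x) ∂μ ≠ ⊤) :
    (∀ᵐ θ ∂volume.restrict (posSet Θ q), Integrable (fun x => T x ^ 2 * f θ x) μ) ∧
      IntegrableOn (fun θ => q θ * ∫ x, T x ^ 2 * f θ x ∂μ) (posSet Θ q) := by
  have hm : Measurable fun z : (Fin p → ℝ) × X => ENNReal.ofReal (T z.2 ^ 2 * f z.1 z.2) :=
    (((hT.comp measurable_snd).pow_const 2).mul hf.meas).ennreal_ofReal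
  have hm2 : AEMeasurable (fun θ => ENNReal.ofReal (q θ) *
      ∫⁻ x, ENNReal.ofReal (T x ^ 2 * f θ x) ∂μ) (volume.restrict (posSet Θ q)) :=
    (aemeasurable_posSet hΘ hq).ennreal_ofReal.mul hm.lintegral_prod_right'.aemeasurable
  have hTm : ∀ θ, Measurable fun x => T x ^ 2 * f θ x := fun θ =>
    (hT.pow_const 2).mul (hf.measurable θ)
  have hnn : ∀ θ, 0 ≤ᵐ[μ] fun x => T x ^ 2 * f θ x := fun θ =>
    Eventually.of_forall fun x => mul_nonneg (sq_nonneg _) (hf.nonneg θ x)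
  constructor
  · filter_upwards [ae_lt_top' hm2 h, ae_posSet hΘ hq] with θ h1 h2
    refine ⟨(hTm θ).aestronglyMeasurable, ?_⟩
    rw [hasFiniteIntegral_iff_ofReal (hnn θ)]
    exact (ENNReal.lt_top_of_mul_ne_top_right h1.ne (ENNReal.ofReal_pos.2 h2.2).ne')
  · refine (integrable_toReal_of_lintegral_ne_top hm2 h).congr ?_
    filter_upwards [ae_posSet hΘ hq] with θ hθ
    rw [ENNReal.toReal_mul, ENNReal.toReal_ofReal hθ.2.le,
      integral_eq_lintegral_of_nonneg_ae (hnn θ) (hTm θ).aestronglyMeasurable]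

end Model

/-! ### The block matrix as a Gram matrix -/

section VanTreesInequality

variable {p s : ℕ} {X : Type*} [MeasurableSpace X] {μ : Measure X}
  {Θ : Set (Fin p → ℝ)} {f : (Fin p → ℝ) → X → ℝ}
  {Q : Measure (Fin p → ℝ)} {q : (Fin p → ℝ) → ℝ} {ξ' : (Fin p → ℝ) → Fin p → X → ℝ}

theorem IsWellBehavedPrior.meanFisher_apply (hQ : IsWellBehavedPrior Θ Q q) (hΘ : IsOpen Θ)
    (hq : ContinuousOn q Θ) (i k : Fin p) :
    meanFisher μ Θ Q ξ' i k = ∫ θ in posSet Θ q, q θ * (4 * ∫ x, ξ' θ i x * ξ' θ k x ∂μ) := by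
  simp only [meanFisher, fisherModel, Matrix.of_apply, hQ.setIntegral_eq hΘ hq]

variable [SigmaFinite μ]

theorem IsWellBehavedPrior.posSemidef_meanFisher (hQ : IsWellBehavedPrior Θ Q q) (hΘ : IsOpen Θ)
    (hq : ContinuousOn q Θ) (hf : IsModel μ Θ f)
    (hξ : ∀ θ ∈ posSet Θ q, ∀ i, IsL2PartialDeriv μ f θ i (ξ' θ i))
    (hI : IntegrableOn (fun θ => q θ * (fisherModel μ (ξ' θ)).trace) (posSet Θ q)) :
    (meanFisher μ Θ Q ξ').PosSemidef := by
  have h4 : ∀ θ i k, ∫ x, (2 * ξ' θ i x) * (2 * ξ' θ k x) ∂μ =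
      4 * ∫ x, ξ' θ i x * ξ' θ k x ∂μ := by
    intro θ i k
    rw [← integral_const_mul]
    exact integral_congr_ae (Eventually.of_forall fun x => by ring)
  have h := posSemidef_integral_gram (ν := volume.restrict (posSet Θ q)) (μ := μ) (w := q)
    (G := fun θ i x => 2 * ξ' θ i x) ((ae_posSet hΘ hq).mono fun θ hθ => hθ.2.le)
    ((ae_restrict_mem (isOpen_posSet hΘ hq).measurableSet).mono fun θ hθ i =>
      (hξ θ hθ i).1.const_mul 2)
    (fun i k => by
      simp only [h4, mul_left_comm (q _) 4]
      exact (hf.integrableOn_fisher hΘ hq hξ hI i k).const_mul 4)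
  convert h using 1
  ext i k
  rw [hQ.meanFisher_apply hΘ hq, Matrix.of_apply]
  simp only [h4]

theorem IsWellBehavedPrior.posSemidef_fromBlocks (hQ : IsWellBehavedPrior Θ Q q) (hΘ : IsOpen Θ)
    (hq : ContinuousOn q Θ) (hb : VanishesAtBoundary Θ q) (hf : IsModel μ Θ f)
    (hξ : ∀ θ ∈ posSet Θ q, ∀ i, IsL2PartialDeriv μ f θ i (ξ' θ i))
    (hI : IntegrableOn (fun θ => q θ * (fisherModel μ (ξ' θ)).trace) (posSet Θ q))
    {ψ : (Fin p → ℝ) → Fin s → ℝ} (hψ : ∀ j, NiceOn Θ fun θ => ψ θ j)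
    (hψm : ∀ j, AEStronglyMeasurable (fun θ => ψ θ j) (volume.restrict (posSet Θ q)))
    (hψ2 : ∀ j, IntegrableOn (fun θ => q θ * ψ θ j ^ 2) (posSet Θ q))
    (hψd : ∀ i j, IntegrableOn (fun θ => q θ * pderiv i (fun η => ψ η j) θ) (posSet Θ q))
    {S : X → Fin s → ℝ} (hS : ∀ j, Measurable fun x => S x j)
    (hSi : ∀ j, ∀ᵐ θ ∂volume.restrict (posSet Θ q), Integrable (fun x => S x j ^ 2 * f θ x) μ)
    (hSq : ∀ j, IntegrableOn (fun θ => q θ * ∫ x, S x j ^ 2 * f θ x ∂μ) (posSet Θ q)) :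
    (Matrix.fromBlocks
      (Matrix.of fun j l => ∫ θ in posSet Θ q, q θ *
        ∫ x, ((S x j - ψ θ j) * √(f θ x)) * ((S x l - ψ θ l) * √(f θ x)) ∂μ)
      (meanGrad Θ Q ψ).transpose (meanGrad Θ Q ψ)
      (fisherPrior Θ q + meanFisher μ Θ Q ξ')).PosSemidef := by
  have hDmem := ae_restrict_mem (μ := volume) (isOpen_posSet hΘ hq).measurableSet
  have hF := hf.integrableOn_fisher hΘ hq hξ hI
  -- The errors, then the scores of the joint law of parameter and observation, all multiplied by
  -- `√f`.
  let G : (Fin p → ℝ) → Fin s ⊕ Fin p → X → ℝ := fun θ =>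
    Sum.elim (fun j x => (S x j - ψ θ j) * √(f θ x))
      fun i x => pderiv i q θ / q θ * √(f θ x) + 2 * ξ' θ i x
  have h0 : ∀ θ ∈ posSet Θ q, ∀ i, ∫ x, √(f θ x) * ξ' θ i x ∂μ = 0 := fun θ hθ i =>
    hf.integral_sqrt_mul_eq_zero hΘ hθ.1 (hξ θ hθ i)
  have hG : ∀ᵐ θ ∂volume.restrict (posSet Θ q), ∀ k, MemLp (G θ k) 2 μ := by
    filter_upwards [hDmem, ae_all_iff.2 hSi] with θ hθ h1
    rintro (j | i)
    · exact hf.memLp_error hθ.1 (hS j) (h1 j) (ψ θ j)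
    · exact ((hf.memLp_sqrt hθ.1).const_mul _).add ((hξ θ hθ i).1.const_mul 2)
  have hfisher : ∀ i k, (fun θ => q θ * ∫ x, G θ (Sum.inr i) x * G θ (Sum.inr k) x ∂μ)
      =ᵐ[volume.restrict (posSet Θ q)] fun θ => pderiv i q θ * pderiv k q θ / q θ +
        q θ * (4 * ∫ x, ξ' θ i x * ξ' θ k x ∂μ) := by
    intro i k
    filter_upwards [hDmem] with θ hθ
    have hq0 := hθ.2.ne'
    simp only [G, Sum.elim_inr]
    rw [hf.integral_score_mul_score hθ.1 (hξ θ hθ i).1 (hξ θ hθ k).1 (h0 θ hθ i) (h0 θ hθ k)]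
    field_simp
  have hcross : ∀ i j, (fun θ => q θ * ∫ x, G θ (Sum.inr i) x * G θ (Sum.inl j) x ∂μ)
      =ᵐ[volume.restrict (posSet Θ q)] fun θ =>
        ((2 * ∫ x, S x j * (√(f θ x) * ξ' θ i x) ∂μ) * q θ +
          (∫ x, S x j * f θ x ∂μ) * pderiv i q θ) - pderiv i q θ * ψ θ j := by
    intro i j
    filter_upwards [hDmem, hSi j] with θ hθ h1
    have hq0 := hθ.2.ne'
    simp only [G, Sum.elim_inr, Sum.elim_inl]
    rw [hf.integral_score_mul_error hθ.1 (hS j) h1 (hξ θ hθ i).1 (h0 θ hθ i)]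
    field_simp
    ring
  have hfi1 := fun i k => hQ.integrableOn_mul_div hΘ hq i k
  have hfi2 : ∀ i k, IntegrableOn (fun θ => q θ * (4 * ∫ x, ξ' θ i x * ξ' θ k x ∂μ))
      (posSet Θ q) := fun i k => by
    simp only [mul_left_comm (q _) 4]
    exact (hF i k).const_mul 4
  have hci1 : ∀ i j, IntegrableOn (fun θ => (2 * ∫ x, S x j * (√(f θ x) * ξ' θ i x) ∂μ) * q θ +
      (∫ x, S x j * f θ x ∂μ) * pderiv i q θ) (posSet Θ q) := fun i j => by
    refine (hf.integrableOn_score hΘ hq hξ (hF i i) (hS j) (hSi j) (hSq j)).add ?_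
    simp only [mul_comm _ (pderiv i q _)]
    exact hQ.integrableOn_pderiv_mul hΘ hq i
      (hf.stronglyMeasurable_integral (hS j)).aestronglyMeasurable
      (hf.integrableOn_mul_sq_integral hΘ hq (hS j) (hSi j) (hSq j))
  have hci2 : ∀ i j, IntegrableOn (fun θ => pderiv i q θ * ψ θ j) (posSet Θ q) := fun i j =>
    hQ.integrableOn_pderiv_mul hΘ hq i (hψm j) (hψ2 j)
  -- The part with the statistic integrates to zero; what remains, `-∫ ψ_j ∂ᵢq`, equals `∫ q ∂ᵢψ_j`
  -- by parts.
  have hcint : ∀ i j, ∫ θ in posSet Θ q, q θ * ∫ x, G θ (Sum.inr i) x * G θ (Sum.inl j) x ∂μ =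
      meanGrad Θ Q ψ i j := by
    intro i j
    have hparts := hQ.setIntegral_pderiv_mul_add hΘ hq hb i (hψ j) (hψm j) (hψ2 j) (hψd i j)
    simp only [mul_comm _ (q _), mul_comm _ (pderiv i q _)] at hparts
    rw [integral_add (hψd i j) (hci2 i j)] at hparts
    rw [integral_congr_ae (hcross i j), integral_sub (hci1 i j) (hci2 i j),
      hQ.setIntegral_statistic hΘ hq hb hf hξ (hF i i) (hS j) (hSi j) (hSq j), zero_sub,
      meanGrad, Matrix.of_apply, hQ.setIntegral_eq hΘ hq]
    linarith
  have hcomm : ∀ θ k l, ∫ x, G θ k x * G θ l x ∂μ = ∫ x, G θ l x * G θ k x ∂μ := fun θ k l => by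
    simp only [mul_comm]
  have hgram := posSemidef_integral_gram (ν := volume.restrict (posSet Θ q)) (μ := μ) (w := q)
    (G := G) ((ae_posSet hΘ hq).mono fun θ hθ => hθ.2.le) hG (by
      have hc : ∀ i j, IntegrableOn (fun θ => q θ *
          ∫ x, G θ (Sum.inr i) x * G θ (Sum.inl j) x ∂μ) (posSet Θ q) := fun i j =>
        ((hci1 i j).sub (hci2 i j)).congr (hcross i j).symm
      rintro (j | i) (l | k)
      · exact hf.integrableOn_error hΘ hq (hS j) (hS l) (hSi j) (hSi l) (hSq j) (hSq l)
          (hψm j) (hψm l) (hψ2 j) (hψ2 l)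
      · simp only [hcomm _ (Sum.inl j)]
        exact hc k j
      · exact hc i l
      · exact ((hfi1 i k).add (hfi2 i k)).congr (hfisher i k).symm)
  convert hgram using 1
  ext (j | i) (l | k)
  · rfl
  · rw [Matrix.fromBlocks_apply₁₂, Matrix.transpose_apply, Matrix.of_apply, ← hcint]
    simp only [hcomm _ (Sum.inl j)]
  · rw [Matrix.fromBlocks_apply₂₁, Matrix.of_apply, hcint]
  · rw [Matrix.fromBlocks_apply₂₂, Matrix.of_apply, integral_congr_ae (hfisher i k),
      integral_add (hfi1 i k) (hfi2 i k), Matrix.add_apply, fisherPrior_apply hΘ hq,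
      hQ.meanFisher_apply hΘ hq]

end VanTreesInequality

/-! ### Extending the densities beyond the parameter set -/

section Extension

variable {p : ℕ} {X : Type*} [MeasurableSpace X] {μ : Measure X}
  {Θ : Set (Fin p → ℝ)} {f : (Fin p → ℝ) → X → ℝ}

/-- The extension by zero of the densities of a model to all of `ℝ^p`. -/
noncomputable def extendByZero (Θ : Set (Fin p → ℝ)) (f : (Fin p → ℝ) → X → ℝ) :
    (Fin p → ℝ) → X → ℝ := Θ.indicator f

/-- The given densities are controlled only over `Θ`, while the measurability arguments above run
over all of `ℝ^p`. Extending by zero reconciles the two without changing any derivative at a point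
of the open set `Θ`. -/
theorem isModel_extendByZero (hΘ : IsOpen Θ) {P : (Fin p → ℝ) → Measure X}
    (hP : ∀ θ ∈ Θ, IsProbabilityMeasure (P θ)) (hf0 : ∀ θ ∈ Θ, ∀ x, 0 ≤ f θ x)
    (hfm : Measurable (fun z : Θ × X => f z.1 z.2))
    (hPf : ∀ θ ∈ Θ, P θ = μ.withDensity (fun x => ENNReal.ofReal (f θ x))) :
    IsModel μ Θ (extendByZero Θ f) where
  meas := by
    have hs : MeasurableSet (Prod.fst ⁻¹' Θ : Set ((Fin p → ℝ) × X)) :=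
      measurable_fst hΘ.measurableSet
    refine measurable_of_restrict_of_restrict_compl hs ?_ ?_
    · have hm : Measurable fun z : (Prod.fst ⁻¹' Θ : Set ((Fin p → ℝ) × X)) =>
          ((⟨z.1.1, z.2⟩ : Θ), z.1.2) :=
        ((measurable_fst.comp measurable_subtype_coe).subtype_mk).prodMk
          (measurable_snd.comp measurable_subtype_coe)
      convert hfm.comp hm using 1
      funext z
      have hz : z.1.1 ∈ Θ := z.2
      simp [extendByZero, Function.uncurry, hz]
    · convert measurable_const (a := (0 : ℝ)) using 1
      funext z
      have hz : z.1.1 ∉ Θ := z.2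
      simp [extendByZero, Function.uncurry, hz]
  nonneg θ x := by
    by_cases h : θ ∈ Θ
    · simpa [extendByZero, h] using hf0 θ h x
    · simp [extendByZero, h]
  lintegral θ hθ := by
    have := (hP θ hθ).measure_univ
    rw [hPf θ hθ, withDensity_apply _ MeasurableSet.univ, Measure.restrict_univ] at this
    simpa [extendByZero, hθ] using this

theorem isL2PartialDeriv_extendByZero (hΘ : IsOpen Θ) {θ : Fin p → ℝ} (hθ : θ ∈ Θ) {i : Fin p}
    {g : X → ℝ} (h : IsL2PartialDeriv μ f θ i g) :
    IsL2PartialDeriv μ (extendByZero Θ f) θ i g := by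
  refine ⟨h.1, h.2.congr' ?_ EventuallyEq.rfl⟩
  filter_upwards [eventually_update_mem hΘ hθ i] with t ht
  simp [extendByZero, ht, hθ]

end Extension

end VanTrees

/-! ### The multivariate van Trees inequality -/

open VanTrees

theorem theorem2 {p s : ℕ} (hp : 2 ≤ p)
    {X : Type*} [MeasurableSpace X] (μ : Measure X) [SigmaFinite μ]
    (Θ : Set (Fin p → ℝ)) (hΘ : IsOpen Θ)
    -- the statistical model and its densities
    (P : (Fin p → ℝ) → Measure X) (hP : ∀ θ ∈ Θ, IsProbabilityMeasure (P θ))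
    (f : (Fin p → ℝ) → X → ℝ) (hf_nonneg : ∀ θ ∈ Θ, ∀ x, 0 ≤ f θ x)
    (hf_meas : Measurable (fun z : Θ × X => f z.1 z.2))
    (hPf : ∀ θ ∈ Θ, P θ = μ.withDensity (fun x => ENNReal.ofReal (f θ x)))
    -- the prior and its density
    (Q : Measure (Fin p → ℝ)) (q : (Fin p → ℝ) → ℝ)
    (hQ : VanTrees.IsWellBehavedPrior Θ Q q) (hq_cont : ContinuousOn q Θ)
    (hq_bd : VanTrees.VanishesAtBoundary Θ q)
    -- differentiability of the model along canonical directions where the prior is positive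
    (ξ' : (Fin p → ℝ) → Fin p → X → ℝ)
    (hξ' : ∀ θ ∈ Θ, 0 < q θ → ∀ i, VanTrees.IsL2PartialDeriv μ f θ i (ξ' θ i))
    (hI : IntegrableOn (fun θ => (VanTrees.fisherModel μ (ξ' θ)).trace) Θ Q)
    -- the target
    (ψ : (Fin p → ℝ) → Fin s → ℝ) (hψ_nice : ∀ j, VanTrees.NiceOn Θ (fun θ => ψ θ j))
    (hψ_sq : ∀ j, MemLp (fun θ => ψ θ j) 2 (Q.restrict Θ))
    (hψ_grad : ∀ i j, IntegrableOn (VanTrees.pderiv i (fun θ => ψ θ j)) Θ Q)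
    -- the statistic
    (S : X → Fin s → ℝ) (hS_meas : Measurable S)
    (hS_sq : ∫⁻ θ in Θ, (∫⁻ x, ENNReal.ofReal (∑ j, S x j ^ 2) ∂(P θ)) ∂Q < ⊤) :
    (Matrix.fromBlocks
        (VanTrees.meanError P Θ Q S ψ) (VanTrees.meanGrad Θ Q ψ).transpose
        (VanTrees.meanGrad Θ Q ψ)
        (VanTrees.fisherPrior Θ q + VanTrees.meanFisher μ Θ Q ξ')).PosSemidef ∧
      (VanTrees.fisherPrior Θ q).PosDef ∧
      (VanTrees.meanError P Θ Q S ψ -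
        (VanTrees.meanGrad Θ Q ψ).transpose *
          (VanTrees.fisherPrior Θ q + VanTrees.meanFisher μ Θ Q ξ')⁻¹ *
          VanTrees.meanGrad Θ Q ψ).PosSemidef := by
  set F := extendByZero Θ f
  have hF : IsModel μ Θ F := isModel_extendByZero hΘ hP hf_nonneg hf_meas hPf
  have hFf : ∀ θ ∈ Θ, F θ = f θ := fun θ hθ => Set.indicator_of_mem hθ f
  have hξF : ∀ θ ∈ posSet Θ q, ∀ i, IsL2PartialDeriv μ F θ i (ξ' θ i) := fun θ hθ i =>
    isL2PartialDeriv_extendByZero hΘ hθ.1 (hξ' θ hθ.1 hθ.2 i)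
  have hIF := (hQ.integrableOn_iff hΘ hq_cont).1 hI
  have hS : ∀ j, Measurable fun x => S x j := fun j => (measurable_pi_apply j).comp hS_meas
  have hψm : ∀ j, AEStronglyMeasurable (fun θ => ψ θ j) (volume.restrict (posSet Θ q)) :=
    fun j => hQ.aestronglyMeasurable hΘ hq_cont (hψ_sq j).1
  have hψ2 : ∀ j, IntegrableOn (fun θ => q θ * ψ θ j ^ 2) (posSet Θ q) := fun j =>
    (hQ.integrableOn_iff hΘ hq_cont).1 (hψ_sq j).integrable_sq
  have hψd : ∀ i j, IntegrableOn (fun θ => q θ * pderiv i (fun η => ψ η j) θ) (posSet Θ q) :=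
    fun i j => (hQ.integrableOn_iff hΘ hq_cont).1 (hψ_grad i j)
  have hSint : ∀ j, ∫⁻ θ in posSet Θ q, ENNReal.ofReal (q θ) *
      ∫⁻ x, ENNReal.ofReal (S x j ^ 2 * F θ x) ∂μ ≠ ⊤ := by
    intro j
    have hm : Measurable fun z : (Fin p → ℝ) × X => ENNReal.ofReal (S z.2 j ^ 2 * F z.1 z.2) :=
      ((((hS j).comp measurable_snd).pow_const 2).mul hF.meas).ennreal_ofReal
    have h1 : ∫⁻ θ in Θ, (∫⁻ x, ENNReal.ofReal (S x j ^ 2 * F θ x) ∂μ) ∂Q < ⊤ := by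
      refine lt_of_le_of_lt (setLIntegral_mono_ae' hΘ.measurableSet
        (Eventually.of_forall fun θ hθ => ?_)) hS_sq
      have hfm : Measurable (f θ) := hFf θ hθ ▸ hF.measurable θ
      rw [hPf θ hθ, lintegral_withDensity_eq_lintegral_mul₀ hfm.ennreal_ofReal.aemeasurable
        (Finset.measurable_fun_sum _ fun j _ => (hS j).pow_const 2).ennreal_ofReal.aemeasurable]
      refine lintegral_mono fun x => ?_
      rw [Pi.mul_apply, ← ENNReal.ofReal_mul (hf_nonneg θ hθ x), hFf θ hθ, mul_comm]
      refine ENNReal.ofReal_le_ofReal (mul_le_mul_of_nonneg_left ?_ (hf_nonneg θ hθ x))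
      exact Finset.single_le_sum (f := fun j => S x j ^ 2) (fun _ _ => sq_nonneg _)
        (Finset.mem_univ j)
    rw [hQ.restrict_eq hΘ hq_cont, lintegral_withDensity_eq_lintegral_mul₀
      (aemeasurable_posSet hΘ hq_cont).real_toNNReal.coe_nnreal_ennreal
      hm.lintegral_prod_right'.aemeasurable] at h1
    exact h1.ne
  have hSi := fun j => (hF.integrable_of_lintegral hΘ hq_cont (hS j) (hSint j)).1
  have hSq := fun j => (hF.integrable_of_lintegral hΘ hq_cont (hS j) (hSint j)).2
  -- Splitting the density as `√f * √f` turns the error under `P θ` into an inner product in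
  -- `L²(μ)`.
  have hErr : meanError P Θ Q S ψ = Matrix.of fun j l => ∫ θ in posSet Θ q, q θ *
      ∫ x, ((S x j - ψ θ j) * √(F θ x)) * ((S x l - ψ θ l) * √(F θ x)) ∂μ := by
    ext j l
    simp only [meanError, Matrix.of_apply, hQ.setIntegral_eq hΘ hq_cont]
    refine integral_congr_ae ?_
    filter_upwards [ae_posSet hΘ hq_cont] with θ hθ
    have hfm : Measurable (f θ) := hFf θ hθ.1 ▸ hF.measurable θ
    rw [hPf θ hθ.1, integral_withDensity_eq_integral_toReal_smul hfm.ennreal_ofReal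
      (Eventually.of_forall fun _ => ENNReal.ofReal_lt_top)]
    congr 1
    refine integral_congr_ae (Eventually.of_forall fun x => ?_)
    simp only [smul_eq_mul, hFf θ hθ.1, ENNReal.toReal_ofReal (hf_nonneg θ hθ.1 x)]
    nth_rewrite 1 [← Real.mul_self_sqrt (hf_nonneg θ hθ.1 x)]
    ring
  have hblock := hQ.posSemidef_fromBlocks hΘ hq_cont hq_bd hF hξF hIF hψ_nice hψm hψ2 hψd hS
    hSi hSq
  rw [← hErr] at hblock
  have hPD := hQ.posDef_fisherPrior hΘ hq_cont hq_bd
  have hsum : (fisherPrior Θ q + meanFisher μ Θ Q ξ').PosDef :=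
    hPD.add_posSemidef (hQ.posSemidef_meanFisher hΘ hq_cont hF hξF hIF)
  refine ⟨hblock, hPD, ?_⟩
  -- With the lower right block positive definite, the block matrix is positive semidefinite exactly
  -- when its Schur complement is.
  let := hsum.isUnit.invertible
  have h := Matrix.PosDef.fromBlocks₂₂ (meanError P Θ Q S ψ) (meanGrad Θ Q ψ).transpose hsum
  simp only [Matrix.conjTranspose_eq_transpose_of_trivial, Matrix.transpose_transpose] at h
  exact h.1 hblock
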